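/- Let $\ell\in\frac12\mathbb N$ (with $0\in\mathbb N$), and index the rows and columns of matrices in $M_{2\ell+1}(\mathbb C)$ by $0,\dots,2\ell$; $E_{ij}$ are the matrix units (zero if an index is out of range), $e_i$ the standard basis vectors and $(a)_k=a(a+1)\cdots(a+k-1)$. Let $U_k$ be the Chebyshev polynomials of the second kind, and let $W(x)$, $x\in[-1,1]$, be the symmetric matrix with, for $m\le n$, $$W(x)_{n,m}=\sqrt{1-x^2}\sum_{t=0}^m\alpha_t(m,n)\,U_{n+m-2t}(x),\qquad \alpha_t(m,n)=\frac{2\ell+1}{n+1}\,\frac{(2\ell-m)!\,m!}{(2\ell)!}\,(-1)^{m-t}\,\frac{(n-2\ell)_{m-t}}{(n+2)_{m-t}}\,\frac{(2\ell+2-t)_t}{t!}.$$ Then there is exactly one sequence $(P_n)_{n\ge0}$ of polynomials with coefficients in $M_{2\ell+1}(\mathbb C)$ such that $P_n$ has degree $n$ and leading coefficient $I$, and $\int_{-1}^1P_n(x)W(x)P_m(x)^*\,dx=\delta_{nm}H_n$ with $H_n$ positive definite. Put $R_n(u)=(-2)^{-n}P_n(1-2u)$. Let $$C=-\sum_{i}\tfrac{2\ell-i}{2}E_{i,i+1}+\tfrac{2\ell+3}{2}I-\sum_i\tfrac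 i2E_{i,i-1},\quad U=(2\ell+3)I,\quad V=-\sum_i i(2\ell-i)E_{ii},$$ $$B_0=-\sum_i\tfrac{2\ell-i}{4\ell}E_{i,i+1}+\sum_i\tfrac{\ell-i}{2\ell}E_{ii}+\sum_i\tfrac{i}{4\ell}E_{i,i-1},\quad B_1=-\sum_i\tfrac{\ell-i}{\ell}E_{ii},\quad A_0=\sum_i\tfrac{(2\ell+2)(i-2\ell)}{2\ell}E_{ii},$$ where $i$ runs over $0,\dots,2\ell$, and $B_0=B_1=A_0=0$ if $\ell=0$. For $\alpha\in\mathbb R$ put $C_\alpha=C+\alpha B_0$, $U_\alpha=U-\alpha B_1$, $V_\alpha=V-\alpha A_0$ and $$\lambda_n^\alpha(i)=-n(n-1)-n(2\ell+3)+i(2\ell-i)+\alpha\Bigl(-\tfrac{n(\ell-i)}{\ell}+\tfrac{(2\ell+2)(i-2\ell)}{2\ell}\Bigr),$$ the term with $\alpha$ being absent if $\ell=0$. For square matrices $A,B,Q$ of the same size such that $Q+k$ is invertible for all $k\in\mathbb N$ let $[Q,A,B]_0=I$, $[Q,A,B]_{k+1}=(Q+k)^{-1}\bigl(k^2+k(A-I)+B\bigr)[Q,A,B]_k$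 and ${}_2H_1(A,B;Q;u)=\sum_{k\ge0}\frac{u^k}{k!}[Q,A,B]_k$. For all $n\in\mathbb N$ and $i\in\{0,\dots,2\ell\}$ the following holds. For every $\alpha\in\mathbb R$, $C_\alpha^t+k$ is invertible for all $k\in\mathbb N$, and the matrix series ${}_2H_1(U_\alpha^t,V_\alpha^t+\lambda_n^\alpha(i);C_\alpha^t;u)$ converges for $|u|<1$. The matrix $[C_\alpha^t,U_\alpha^t,V_\alpha^t+\lambda_n^\alpha(i)]_n$ is invertible for all real $\alpha$ outside a finite set, which contains no irrational number. For every $\alpha$ for which it is invertible, put $$F_{n,i}^\alpha=n!\,[C_\alpha^t,U_\alpha^t,V_\alpha^t+\lambda_n^\alpha(i)]_n^{-1}e_i;$$ then for $0\le j\le 2\ell$ $$\bigl(R_n(u)\bigr)_{ij}=\Bigl({}_2H_1\bigl(U_\alpha^t,V_\alpha^t+\lambda_n^\alpha(i);C_\alpha^t;u\bigr)\,F_{n,i}^\alpha\Bigr)^t_j .$$ For every real $\alpha$, including the finitely many exceptional ones, the limit $\lim_{\beta\to\alpha,\ \beta\ne\alpha}F_{n,i}^\beta$ exists, and the same formula holds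 with this limit in the place of $F_{n,i}^\alpha$. In both cases the formula holds for $|u|<1$ with the matrix-valued function ${}_2H_1$, and for all $u\in\mathbb C$ with ${}_2H_1F$ read as the vector series $\sum_{k\ge0}\frac{u^k}{k!}[C_\alpha^t,U_\alpha^t,V_\alpha^t+\lambda_n^\alpha(i)]_kF$. -/

import Mathlib

open scoped Matrix ComplexOrder Topology

noncomputable section

namespace MVOP

/-! Throughout, `N = 2ℓ`, so `ℓ = N / 2` runs over the half-integers `0, 1/2, 1, 3/2, …`,
and matrices have size `2ℓ + 1 = N + 1`, with rows and columns numbered `0, …, 2ℓ`. -/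

/-- Complex matrices of size `2ℓ + 1`. -/
abbrev Mat (N : ℕ) := Matrix (Fin (N + 1)) (Fin (N + 1)) ℂ

/-- The Pochhammer symbol `(a)_k = a (a + 1) ⋯ (a + k - 1)`. -/
def poch (a : ℝ) (k : ℕ) : ℝ := (ascPochhammer ℝ k).eval a

/-! ### The weight and its monic orthogonal polynomials -/

/-- The coefficient `α_t(m, n)` of the weight, for `0 ≤ t ≤ m ≤ n ≤ 2ℓ`. -/
def weightCoeff (N t m n : ℕ) : ℝ :=
  (((N : ℝ) + 1) / ((n : ℝ) + 1)) *
    (((N - m).factorial : ℝ) * (m.factorial : ℝ) / (N.factorial : ℝ)) *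
    (-1) ^ (m - t) * (poch ((n : ℝ) - N) (m - t) / poch ((n : ℝ) + 2) (m - t)) *
    (poch ((N : ℝ) + 2 - t) t / (t.factorial : ℝ))

/-- `W(x)_{n,m}` for `m ≤ n`. -/
def weightLower (N n m : ℕ) (x : ℝ) : ℝ :=
  Real.sqrt (1 - x ^ 2) *
    ∑ t ∈ Finset.range (m + 1),
      weightCoeff N t m n *
        (Polynomial.Chebyshev.U ℝ ((n : ℤ) + (m : ℤ) - 2 * (t : ℤ))).eval x

/-- The symmetric matrix weight `W` on `[-1, 1]`. -/
def weight (N : ℕ) (x : ℝ) : Mat N :=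
  Matrix.of fun n m =>
    ((weightLower N (max (n : ℕ) (m : ℕ)) (min (n : ℕ) (m : ℕ)) x : ℝ) : ℂ)

/-- The value `∑ₖ xᵏ Pₖ` of the matrix polynomial `P = ∑ₖ Pₖ Xᵏ` at the complex number `x`. -/
def matEval {N : ℕ} (P : Polynomial (Mat N)) (x : ℂ) : Mat N :=
  P.eval (Matrix.scalar (Fin (N + 1)) x)

/-- The matrix-valued inner product `⟨P, Q⟩_W = ∫_{-1}^1 P(x) W(x) Q(x)^* dx`,
the integral being taken entry by entry. -/
def matInner {N : ℕ} (P Q : Polynomial (Mat N)) : Mat N :=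
  Matrix.of fun i j =>
    ∫ x in (-1 : ℝ)..1, (matEval P (x : ℂ) * weight N x * (matEval Q (x : ℂ))ᴴ) i j

/-- `(P_n)` is the sequence of monic matrix-valued orthogonal polynomials for `W`: each `P_n` has
degree `n` and leading coefficient `I`, and `⟨P_n, P_m⟩_W = δ_{nm} H_n` with `H_n` positive
definite. -/
structure IsMonicOrthogonal (N : ℕ) (P : ℕ → Polynomial (Mat N)) : Prop where
  natDegree_eq : ∀ n, (P n).natDegree = n
  monic : ∀ n, (P n).Monic
  orthogonal : ∀ n m, n ≠ m → matInner (P n) (P m) = 0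
  posDef : ∀ n, (matInner (P n) (P n)).PosDef

/-- The rescaled polynomial `R_n(u) = (-1)^n 2^{-n} P_n(1 - 2u)`. -/
def rescaled {N : ℕ} (P : ℕ → Polynomial (Mat N)) (n : ℕ) (u : ℂ) : Mat N :=
  ((-1 : ℂ) ^ n * ((2 : ℂ) ^ n)⁻¹) • matEval (P n) (1 - 2 * u)

/-! ### The matrices of the hypergeometric operators `D`, `E` and `D + α E` -/

/-- The matrix `C` of the second order operator. -/
def matC (N : ℕ) : Mat N := Matrix.of fun i j =>
  if (j : ℕ) = (i : ℕ) + 1 then -(((N : ℂ) - (i : ℕ)) / 2)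
  else if j = i then ((N : ℂ) + 3) / 2
  else if (i : ℕ) = (j : ℕ) + 1 then -(((i : ℕ) : ℂ) / 2)
  else 0

/-- `U = (2ℓ + 3) I`. -/
def matU (N : ℕ) : Mat N := ((N : ℂ) + 3) • (1 : Mat N)

/-- `V = -∑ᵢ i (2ℓ - i) E_{ii}`. -/
def matV (N : ℕ) : Mat N :=
  Matrix.diagonal fun i => -(((i : ℕ) : ℂ) * ((N : ℂ) - (i : ℕ)))

/- The first order operator `E` has no analogue for `ℓ = 0`. In that case the numerators in the
next three definitions vanish together with the denominators, so that `B₀ = B₁ = A₀ = 0`. -/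

/-- `B₁ = -∑ᵢ (ℓ - i) / ℓ E_{ii}`. -/
def matB1 (N : ℕ) : Mat N :=
  Matrix.diagonal fun i => -(((N : ℂ) / 2 - (i : ℕ)) / ((N : ℂ) / 2))

/-- The matrix `B₀` of the first order operator; note `4ℓ = 2N` and `2ℓ = N`. -/
def matB0 (N : ℕ) : Mat N := Matrix.of fun i j =>
  if (j : ℕ) = (i : ℕ) + 1 then -(((N : ℂ) - (i : ℕ)) / (2 * N))
  else if j = i then ((N : ℂ) / 2 - (i : ℕ)) / N
  else if (i : ℕ) = (j : ℕ) + 1 then ((i : ℕ) : ℂ) / (2 * N)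
  else 0

/-- `A₀ = ∑ᵢ (2ℓ + 2)(i - 2ℓ) / (2ℓ) E_{ii}`. -/
def matA0 (N : ℕ) : Mat N :=
  Matrix.diagonal fun i => ((N : ℂ) + 2) * (((i : ℕ) : ℂ) - N) / N

/-- `C_α = C + α B₀`. -/
def Cα (N : ℕ) (α : ℝ) : Mat N := matC N + (α : ℂ) • matB0 N

/-- `U_α = U - α B₁`. -/
def Uα (N : ℕ) (α : ℝ) : Mat N := matU N - (α : ℂ) • matB1 N

/-- `V_α = V - α A₀`. -/
def Vα (N : ℕ) (α : ℝ) : Mat N := matV N - (α : ℂ) • matA0 N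

/-- The `i`-th diagonal entry of the eigenvalue matrix `Λ_n(D)`. -/
def eigD (N n : ℕ) (i : Fin (N + 1)) : ℂ :=
  -((n : ℂ) * ((n : ℂ) - 1)) - (n : ℂ) * ((N : ℂ) + 3) + ((i : ℕ) : ℂ) * ((N : ℂ) - (i : ℕ))

/-- The `i`-th diagonal entry of the eigenvalue matrix `Λ_n(E)` (zero if `ℓ = 0`). -/
def eigE (N n : ℕ) (i : Fin (N + 1)) : ℂ :=
  -((n : ℂ) * ((N : ℂ) / 2 - (i : ℕ)) / ((N : ℂ) / 2)) +
    ((N : ℂ) + 2) * (((i : ℕ) : ℂ) - N) / N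

/-- `λ_n^α(i) = Λ_n(D)_{ii} + α Λ_n(E)_{ii}`. -/
def eig (N n : ℕ) (α : ℝ) (i : Fin (N + 1)) : ℂ := eigD N n i + (α : ℂ) * eigE N n i

/-! ### Tirao's matrix-valued hypergeometric function -/

/-- `[C, U, V]_0 = 1`, `[C, U, V]_{k+1} = (C + k)⁻¹ (k² + k (U - 1) + V) [C, U, V]_k`. -/
def bracket {N : ℕ} (C U V : Mat N) : ℕ → Mat N
  | 0 => 1
  | k + 1 =>
      (C + (k : ℂ) • (1 : Mat N))⁻¹ *
        ((k : ℂ) ^ 2 • (1 : Mat N) + (k : ℂ) • (U - 1) + V) * bracket C U V k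

/-- `₂H₁(U, V; C; z) = ∑ₖ (zᵏ / k!) [C, U, V]_k`. -/
def hyp2H1 {N : ℕ} (U V C : Mat N) (z : ℂ) : Mat N :=
  ∑' k : ℕ, (z ^ k / (k.factorial : ℂ)) • bracket C U V k

/-- `V_αᵗ + λ_n^α(i)`. -/
def shiftedV (N n : ℕ) (α : ℝ) (i : Fin (N + 1)) : Mat N :=
  (Vα N α)ᵀ + eig N n α i • (1 : Mat N)

/-- `[C_αᵗ, U_αᵗ, V_αᵗ + λ_n^α(i)]_k`. -/
def rowBracket (N n : ℕ) (α : ℝ) (i : Fin (N + 1)) (k : ℕ) : Mat N :=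
  bracket (Cα N α)ᵀ (Uα N α)ᵀ (shiftedV N n α i) k

/-- `₂H₁(U_αᵗ, V_αᵗ + λ_n^α(i); C_αᵗ; u)`. -/
def rowHyp (N n : ℕ) (α : ℝ) (i : Fin (N + 1)) (u : ℂ) : Mat N :=
  hyp2H1 (Uα N α)ᵀ (shiftedV N n α i) (Cα N α)ᵀ u

/-- `n! [C_αᵗ, U_αᵗ, V_αᵗ + λ_n^α(i)]_n⁻¹ e_i`. -/
def rowStart (N n : ℕ) (α : ℝ) (i : Fin (N + 1)) : Fin (N + 1) → ℂ :=
  (n.factorial : ℂ) • ((rowBracket N n α i n)⁻¹ *ᵥ Pi.single i 1)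

/-- The `i`-th row of `R_n` is `(₂H₁(U_αᵗ, V_αᵗ + λ_n^α(i); C_αᵗ; u) F)ᵗ`: with the matrix-valued
function `₂H₁` in the disc `|u| < 1` where its series converges, and for every `u ∈ ℂ` with the
vector-valued series obtained by applying the coefficients of `₂H₁` to `F`. -/
def RowFormula (N : ℕ) (P : ℕ → Polynomial (Mat N)) (n : ℕ) (α : ℝ) (i : Fin (N + 1))
    (F : Fin (N + 1) → ℂ) : Prop :=
  (∀ u : ℂ, ‖u‖ < 1 → ∀ j, rescaled P n u i j = (rowHyp N n α i u *ᵥ F) j) ∧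
  (∀ u : ℂ, ∀ j, HasSum
    (fun k : ℕ => u ^ k / (k.factorial : ℂ) * (rowBracket N n α i k *ᵥ F) j)
    (rescaled P n u i j))

end MVOP

end

/-! The second order operator `D` and the first order operator `E` have their coefficients on the
right, do not raise degrees, and are symmetric for the matrix inner product
(`matInner_diffOp_symm`). Hence every `P_n` is an eigenfunction of `D + α E`, with a diagonal
eigenvalue acting from the left (`IsMonicOrthogonal.diffOp_eq`, `diffOp_comb_eq`), and the rows
decouple. After `x = 1 - 2u` the transposed `i`-th row is a polynomial solution of Tirao's
hypergeometric equation.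

Since `C_αᵗ + k` is always invertible (`isUnit_Cα_add`), the Taylor coefficients of the row at `u =
0` are the brackets applied to its value at `0` (`rowCoeff_rec`, `rowBracket_mulVec`). The
coefficient of `uⁿ` is `e_i` by monicity, and this recovers the value at `0` whenever the `n`-th
bracket is invertible. The numerator of the `k`-th step is the diagonal matrix with entries
`λ_n^α(i) - λ_k^α(j)` (`step_eq_diagonal`). The eigenvalues of `D` and `E` together separate `(n,
i)` from `(k, j)` for `k < n` (`eig_pair_separate`), so only finitely many `α`, all rational, can
fail. The vector obtained is always the row of `R_n(0)`, which does not depend on `α`; this settles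
the exceptional values and the limit.

Symmetry and positivity rest on the weight at `x = cos θ`. Its entries, multiplied by binomial
coefficients, are sums of sines obeying a one-step recurrence along antidiagonals, and the symmetry
equations become trigonometric identities provable by induction. A generating function gives the
factorization `W = sin θ · L Lᴴ` with `L` invertible for `0 < θ < π` (`angularWeight_eq_mul`,
`weight_posDef`), hence orthogonal polynomials by Gram–Schmidt. -/

noncomputable section

namespace MVOP

/-! ### The weight in the variable `x = cos θ` -/

/-- `sinKernel N θ (a + 1) (b + 1)` is the entry `(a, b)` of the weight at `cos θ`, multiplied by
the binomial coefficients `N.choose a * N.choose b`. -/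
def sinKernel (N : ℕ) (θ : ℝ) : ℕ → ℕ → ℝ
  | _, 0 => 0
  | a, b + 1 => sinKernel N θ (a + 1) b +
      ((N + 1).choose b : ℝ) * ((N + 1).choose a : ℝ) * Real.sin (((a : ℝ) - b) * θ)

/-- The derivative of `sinKernel` with respect to `θ`. -/
def sinKernelDeriv (N : ℕ) (θ : ℝ) : ℕ → ℕ → ℝ
  | _, 0 => 0
  | a, b + 1 => sinKernelDeriv N θ (a + 1) b +
      ((N + 1).choose b : ℝ) * ((N + 1).choose a : ℝ) *
        (((a : ℝ) - b) * Real.cos (((a : ℝ) - b) * θ))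

lemma sinKernel_zero (N : ℕ) (θ : ℝ) (a : ℕ) : sinKernel N θ a 0 = 0 := by
  simp [sinKernel]

lemma sinKernel_succ (N : ℕ) (θ : ℝ) (a b : ℕ) : sinKernel N θ a (b + 1) =
    sinKernel N θ (a + 1) b +
      ((N + 1).choose b : ℝ) * ((N + 1).choose a : ℝ) * Real.sin (((a : ℝ) - b) * θ) := rfl

lemma sinKernelDeriv_zero (N : ℕ) (θ : ℝ) (a : ℕ) : sinKernelDeriv N θ a 0 = 0 := by
  simp [sinKernelDeriv]

lemma sinKernelDeriv_succ (N : ℕ) (θ : ℝ) (a b : ℕ) : sinKernelDeriv N θ a (b + 1) =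
    sinKernelDeriv N θ (a + 1) b +
      ((N + 1).choose b : ℝ) * ((N + 1).choose a : ℝ) *
        (((a : ℝ) - b) * Real.cos (((a : ℝ) - b) * θ)) := rfl

lemma hasDerivAt_sinKernel (N a b : ℕ) (θ : ℝ) :
    HasDerivAt (fun t => sinKernel N t a b) (sinKernelDeriv N θ a b) θ := by
  induction b generalizing a with
  | zero => simpa only [sinKernel_zero, sinKernelDeriv_zero] using hasDerivAt_const θ (0 : ℝ)
  | succ b ih =>
    simp only [sinKernel_succ, sinKernelDeriv_succ]
    refine (ih (a + 1)).add (HasDerivAt.const_mul _ ?_)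
    have h := ((hasDerivAt_id θ).const_mul ((a : ℝ) - b)).sin
    simpa [mul_comm] using h

lemma sinKernel_at_zero (N a b : ℕ) : sinKernel N 0 a b = 0 := by
  induction b generalizing a with
  | zero => exact sinKernel_zero _ _ _
  | succ b ih => simp [sinKernel_succ, ih]

lemma sinKernel_at_pi (N a b : ℕ) : sinKernel N Real.pi a b = 0 := by
  induction b generalizing a with
  | zero => exact sinKernel_zero _ _ _
  | succ b ih =>
    have h := Real.sin_int_mul_pi ((a : ℤ) - b)
    push_cast at h
    simp [sinKernel_succ, ih, h]

lemma sinKernel_eq_zero_of_lt (N : ℕ) (θ : ℝ) (a b : ℕ) (h : N + 1 < a) :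
    sinKernel N θ a b = 0 := by
  induction b generalizing a with
  | zero => exact sinKernel_zero _ _ _
  | succ b ih => simp [sinKernel_succ, ih (a + 1) (by omega), Nat.choose_eq_zero_of_lt h]

/-- The explicit form, to be matched with the Chebyshev sum. The recurrence serves as the definition
because the identities below are proved by induction on the second index. -/
lemma sinKernel_eq_sum (N : ℕ) (θ : ℝ) (a b : ℕ) : sinKernel N θ (a + 1) (b + 1) =
    ∑ t ∈ Finset.range (b + 1), ((N + 1).choose t : ℝ) * ((N + 1).choose (a + b + 1 - t) : ℝ) *
      Real.sin (((a : ℝ) + b + 1 - 2 * t) * θ) := by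
  induction b generalizing a with
  | zero => simp [sinKernel_succ, sinKernel_zero]
  | succ b ih =>
    rw [sinKernel_succ, ih, Finset.sum_range_succ _ (b + 1)]
    congr 1
    · refine Finset.sum_congr rfl fun t _ => ?_
      rw [show a + 1 + b + 1 - t = a + (b + 1) + 1 - t by omega]
      push_cast
      ring_nf
    · rw [show a + (b + 1) + 1 - (b + 1) = a + 1 by omega]
      push_cast
      ring_nf

/-- Read from its two ends, an antidiagonal contributes opposite sines. The index difference `d + 2`
is reached from `d`, so the induction carries two consecutive differences. -/
lemma sinKernel_comm_aux (N : ℕ) (θ : ℝ) (d b : ℕ) :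
    sinKernel N θ (b + d) b = sinKernel N θ b (b + d) ∧
      sinKernel N θ (b + d + 1) b = sinKernel N θ b (b + d + 1) := by
  induction d generalizing b with
  | zero => exact ⟨rfl, by simp [sinKernel_succ N θ b b]⟩
  | succ d ih =>
    refine ⟨(ih b).2, ?_⟩
    have h1 := (ih (b + 1)).1
    have h2 := sinKernel_succ N θ b (b + d + 1)
    have h3 := sinKernel_succ N θ (b + d + 1) b
    rw [show b + 1 + d = b + d + 1 by ring] at h1
    have h4 : Real.sin (((b : ℝ) - ((b + d + 1 : ℕ) : ℝ)) * θ) =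
        -Real.sin ((((b + d + 1 : ℕ) : ℝ) - b) * θ) := by
      rw [← Real.sin_neg]; ring_nf
    rw [h4] at h2
    rw [show b + (d + 1) + 1 = b + d + 1 + 1 by ring]
    linear_combination h1 - h2 - h3

lemma sinKernel_comm (N : ℕ) (θ : ℝ) (a b : ℕ) : sinKernel N θ a b = sinKernel N θ b a := by
  rcases le_total a b with h | h
  · obtain ⟨d, rfl⟩ := Nat.exists_eq_add_of_le h
    exact (sinKernel_comm_aux N θ d a).1.symm
  · obtain ⟨d, rfl⟩ := Nat.exists_eq_add_of_le h
    exact (sinKernel_comm_aux N θ d b).1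

lemma choose_succ_eq_div (n k : ℕ) :
    (n.choose (k + 1) : ℝ) = (n.choose k : ℝ) * ((n : ℝ) - k) / ((k : ℝ) + 1) := by
  have hk : (k : ℝ) + 1 ≠ 0 := by positivity
  rw [eq_div_iff hk]
  rcases le_or_gt k n with h | h
  · have := Nat.choose_succ_right_eq n k
    rw [← Nat.cast_sub h]
    exact_mod_cast this
  · simp [Nat.choose_eq_zero_of_lt h, Nat.choose_eq_zero_of_lt (Nat.lt_succ_of_lt h)]

lemma sin_cos_shift (φ θ : ℝ) :
    2 * Real.cos θ * Real.sin φ = Real.sin (φ + θ) + Real.sin (φ - θ) ∧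
    2 * Real.sin θ * Real.sin φ = Real.cos (φ - θ) - Real.cos (φ + θ) ∧
    2 * Real.cos θ * Real.cos φ = Real.cos (φ + θ) + Real.cos (φ - θ) ∧
    2 * Real.sin θ * Real.cos φ = Real.sin (φ + θ) - Real.sin (φ - θ) := by
  simp only [Real.sin_add, Real.sin_sub, Real.cos_add, Real.cos_sub]
  refine ⟨?_, ?_, ?_, ?_⟩ <;> ring

/-! ### Trigonometric identities behind the symmetry equations. -/

section Identities

variable (N : ℕ) (θ : ℝ)

local notation "T" => sinKernel N θ
local notation "K" => fun k : ℕ => (Nat.choose (N + 1) k : ℝ)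

/-- What remains of `sinKernel_antisymm` once the recurrence has removed `T a (b + 1)` and `T (a +
1) (b + 2)`. The coefficients of the kernel terms depend only on `a + b`, so the induction runs
along an antidiagonal: the cases `(a, b + 1)` and `(a + 1, b)` differ by a few sines, which cancel
by the product formulas and the binomial identity `key`. The next three lemmas follow the same
pattern. -/
lemma sinKernel_reduced_antisymm (a b : ℕ) :
    ((a : ℝ) + b + 2) * T (a + 2) (b + 1) - (2 * N + 2 - a - b) * T (a + 1) b
      - 2 * Real.cos θ * (N - a - b) * T (a + 1) (b + 1)
      + (N - a - b) * (K b * K (a + 1) * Real.sin ((a - b) * θ)) = 0 := by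
  induction b generalizing a with
  | zero =>
    have hc := (sin_cos_shift (((a : ℝ) + 1) * θ) θ).1
    rw [show ((a : ℝ) + 1) * θ + θ = ((a : ℝ) + 2) * θ by ring,
      show ((a : ℝ) + 1) * θ - θ = (a : ℝ) * θ by ring] at hc
    simp only [sinKernel_succ, sinKernel_zero, choose_succ_eq_div _ (a + 1)]
    push_cast
    simp only [Nat.choose_zero_right, sub_zero, Nat.cast_one]
    field_simp
    linear_combination (-(N - a : ℝ)) * (a + 1 + 1) * ((N + 1).choose (a + 1) : ℝ) * hc
  | succ b ih =>
    have ih := ih (a + 1)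
    have e1 := sinKernel_succ N θ (a + 2) (b + 1)
    have e2 := sinKernel_succ N θ (a + 1) b
    have e3 := sinKernel_succ N θ (a + 1) (b + 1)
    have hc := (sin_cos_shift (((a : ℝ) - b) * θ) θ).1
    rw [show ((a : ℝ) - b) * θ + θ = ((a : ℝ) + 1 - b) * θ by ring,
      show ((a : ℝ) - b) * θ - θ = ((a : ℝ) - (b + 1)) * θ by ring] at hc
    have h2 := choose_succ_eq_div (N + 1) (a + 1)
    have h1 := choose_succ_eq_div (N + 1) b
    have key : ((a : ℝ) + b + 3) * (K (b + 1) * K (a + 2)) - (2 * N + 1 - a - b) * (K b * K (a + 1))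
      - (N - a - b - 1) * (K (b + 1) * K (a + 1)) - (N - a - b - 1) * (K b * K (a + 2)) = 0 := by
      simp only [h1, h2]; push_cast; field_simp; ring
    push_cast at *
    rw [show ((a : ℝ) + 2 - (b + 1)) * θ = ((a : ℝ) + 1 - b) * θ by ring] at e1
    rw [show ((a : ℝ) + 1 - (b + 1)) * θ = ((a : ℝ) - b) * θ by ring] at e3
    simp only [add_assoc, Nat.reduceAdd] at *
    linear_combination ih + (a + b + 3) * e1 - (2 * N + 1 - a - b : ℝ) * e2
      - 2 * Real.cos θ * (N - a - b - 1) * e3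
      - (N - a - b - 1 : ℝ) * (((N + 1).choose (b + 1) : ℝ) * ((N + 1).choose (a + 1) : ℝ)) * hc
      + Real.sin (((a : ℝ) + 1 - b) * θ) * key

lemma sinKernelDeriv_reduced_antisymm (a b : ℕ) :
    sinKernelDeriv N θ (a + 2) (b + 1) + sinKernelDeriv N θ (a + 1) b +
      2 * Real.cos θ * sinKernelDeriv N θ (a + 1) (b + 1)
      + 2 * (N + 1) * Real.sin θ * T (a + 1) (b + 1)
      - (N + 2 + a - b) * (K b * K (a + 1) * Real.cos ((a - b) * θ)) = 0 := by
  induction b generalizing a with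
  | zero =>
    obtain ⟨hc1, hc2, hc3, hc4⟩ := sin_cos_shift (((a : ℝ) + 1) * θ) θ
    rw [show ((a : ℝ) + 1) * θ + θ = ((a : ℝ) + 2) * θ by ring,
      show ((a : ℝ) + 1) * θ - θ = (a : ℝ) * θ by ring] at hc1 hc2 hc3 hc4
    simp only [sinKernel_succ, sinKernel_zero, sinKernelDeriv_succ, sinKernelDeriv_zero,
      choose_succ_eq_div _ (a + 1)]
    push_cast
    simp only [Nat.choose_zero_right, sub_zero, Nat.cast_one]
    field_simp
    linear_combination (a + 1 + 1) * (a + 1) * ((N + 1).choose (a + 1) : ℝ) * hc3 +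
      (a + 1 + 1) * (N + 1) * ((N + 1).choose (a + 1) : ℝ) * hc2
  | succ b ih =>
    have ih := ih (a + 1)
    have e1 := sinKernel_succ N θ (a + 2) (b + 1)
    have e2 := sinKernel_succ N θ (a + 1) b
    have e3 := sinKernel_succ N θ (a + 1) (b + 1)
    have d1 := sinKernelDeriv_succ N θ (a + 2) (b + 1)
    have d2 := sinKernelDeriv_succ N θ (a + 1) b
    have d3 := sinKernelDeriv_succ N θ (a + 1) (b + 1)
    obtain ⟨hc1, hc2, hc3, hc4⟩ := sin_cos_shift (((a : ℝ) - b) * θ) θ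
    rw [show ((a : ℝ) - b) * θ + θ = ((a : ℝ) + 1 - b) * θ by ring,
      show ((a : ℝ) - b) * θ - θ = ((a : ℝ) - (b + 1)) * θ by ring] at hc1 hc2 hc3 hc4
    have h2 := choose_succ_eq_div (N + 1) (a + 1)
    have h1 := choose_succ_eq_div (N + 1) b
    have key : ((a : ℝ) + 1 - b) * (K (b + 1) * K (a + 2) + K b * K (a + 1))
      + (a - b - N - 1) * (K (b + 1) * K (a + 1)) + (N + 3 + a - b) * (K b * K (a + 2)) = 0 := by
      simp only [h1, h2]; push_cast; field_simp; ring
    push_cast at *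
    rw [show (a : ℝ) + 2 - (b + 1) = (a : ℝ) + 1 - b by ring] at e1 d1
    rw [show (a : ℝ) + 1 - (b + 1) = (a : ℝ) - b by ring] at e3 d3
    simp only [add_assoc, Nat.reduceAdd] at *
    linear_combination ih + d1 + d2 + 2 * Real.cos θ * d3 + 2 * (N + 1) * Real.sin θ * e3
      + (a - b : ℝ) * (((N + 1).choose (b + 1) : ℝ) * ((N + 1).choose (a + 1) : ℝ)) * hc3
      + (N + 1) * (((N + 1).choose (b + 1) : ℝ) * ((N + 1).choose (a + 1) : ℝ)) * hc2
      + Real.cos (((a : ℝ) + 1 - b) * θ) * key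

lemma sinKernelDeriv_reduced_diff (a b : ℕ) :
    sinKernelDeriv N θ (a + 2) (b + 1) - sinKernelDeriv N θ (a + 1) b +
      2 * Real.sin θ * (N - a - b) * T (a + 1) (b + 1)
      - (N - a - b) * (K b * K (a + 1) * Real.cos ((a - b) * θ)) = 0 := by
  induction b generalizing a with
  | zero =>
    obtain ⟨hc1, hc2, hc3, hc4⟩ := sin_cos_shift (((a : ℝ) + 1) * θ) θ
    rw [show ((a : ℝ) + 1) * θ + θ = ((a : ℝ) + 2) * θ by ring,
      show ((a : ℝ) + 1) * θ - θ = (a : ℝ) * θ by ring] at hc1 hc2 hc3 hc4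
    simp only [sinKernel_succ, sinKernel_zero, sinKernelDeriv_succ, sinKernelDeriv_zero,
      choose_succ_eq_div _ (a + 1)]
    push_cast
    simp only [Nat.choose_zero_right, sub_zero, Nat.cast_one]
    field_simp
    linear_combination (a + 1 + 1) * (N - a) * ((N + 1).choose (a + 1) : ℝ) * hc2
  | succ b ih =>
    have ih := ih (a + 1)
    have e1 := sinKernel_succ N θ (a + 2) (b + 1)
    have e2 := sinKernel_succ N θ (a + 1) b
    have e3 := sinKernel_succ N θ (a + 1) (b + 1)
    have d1 := sinKernelDeriv_succ N θ (a + 2) (b + 1)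
    have d2 := sinKernelDeriv_succ N θ (a + 1) b
    have d3 := sinKernelDeriv_succ N θ (a + 1) (b + 1)
    obtain ⟨hc1, hc2, hc3, hc4⟩ := sin_cos_shift (((a : ℝ) - b) * θ) θ
    rw [show ((a : ℝ) - b) * θ + θ = ((a : ℝ) + 1 - b) * θ by ring,
      show ((a : ℝ) - b) * θ - θ = ((a : ℝ) - (b + 1)) * θ by ring] at hc1 hc2 hc3 hc4
    have h2 := choose_succ_eq_div (N + 1) (a + 1)
    have h1 := choose_succ_eq_div (N + 1) b
    have key : ((a : ℝ) + 1 - b) * (K (b + 1) * K (a + 2) - K b * K (a + 1))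
      - (N - a - b - 1) * (K (b + 1) * K (a + 1)) + (N - a - b - 1) * (K b * K (a + 2)) = 0 := by
      simp only [h1, h2]; push_cast; field_simp; ring
    push_cast at *
    rw [show (a : ℝ) + 2 - (b + 1) = (a : ℝ) + 1 - b by ring] at e1 d1
    rw [show (a : ℝ) + 1 - (b + 1) = (a : ℝ) - b by ring] at e3 d3
    simp only [add_assoc, Nat.reduceAdd] at *
    linear_combination ih + d1 - d2 + 2 * Real.sin θ * (N - a - b - 1) * e3
      + (N - a - b - 1 : ℝ) * (((N + 1).choose (b + 1) : ℝ) * ((N + 1).choose (a + 1) : ℝ)) * hc2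
      + Real.cos (((a : ℝ) + 1 - b) * θ) * key

lemma sinKernelDeriv_reduced_pearson (a b : ℕ) :
    ((a : ℝ) + b + 2) * T (a + 2) (b + 1) + (2 * N + 2 - a - b) * T (a + 1) b
      + (N + 2 + a - b) * (K b * K (a + 1) * Real.sin ((a - b) * θ))
      - 2 * Real.cos θ * (N + 1) * T (a + 1) (b + 1)
      + 2 * Real.sin θ * sinKernelDeriv N θ (a + 1) (b + 1) = 0 := by
  induction b generalizing a with
  | zero =>
    obtain ⟨hc1, hc2, hc3, hc4⟩ := sin_cos_shift (((a : ℝ) + 1) * θ) θ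
    rw [show ((a : ℝ) + 1) * θ + θ = ((a : ℝ) + 2) * θ by ring,
      show ((a : ℝ) + 1) * θ - θ = (a : ℝ) * θ by ring] at hc1 hc2 hc3 hc4
    simp only [sinKernel_succ, sinKernel_zero, sinKernelDeriv_succ, sinKernelDeriv_zero,
      choose_succ_eq_div _ (a + 1)]
    push_cast
    simp only [Nat.choose_zero_right, sub_zero, Nat.cast_one]
    field_simp
    linear_combination -(a + 1 + 1) * (N + 1) * ((N + 1).choose (a + 1) : ℝ) * hc1 +
      (a + 1 + 1) * (a + 1) * ((N + 1).choose (a + 1) : ℝ) * hc4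
  | succ b ih =>
    have ih := ih (a + 1)
    have e1 := sinKernel_succ N θ (a + 2) (b + 1)
    have e2 := sinKernel_succ N θ (a + 1) b
    have e3 := sinKernel_succ N θ (a + 1) (b + 1)
    have d1 := sinKernelDeriv_succ N θ (a + 2) (b + 1)
    have d2 := sinKernelDeriv_succ N θ (a + 1) b
    have d3 := sinKernelDeriv_succ N θ (a + 1) (b + 1)
    obtain ⟨hc1, hc2, hc3, hc4⟩ := sin_cos_shift (((a : ℝ) - b) * θ) θ
    rw [show ((a : ℝ) - b) * θ + θ = ((a : ℝ) + 1 - b) * θ by ring,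
      show ((a : ℝ) - b) * θ - θ = ((a : ℝ) - (b + 1)) * θ by ring] at hc1 hc2 hc3 hc4
    have h2 := choose_succ_eq_div (N + 1) (a + 1)
    have h1 := choose_succ_eq_div (N + 1) b
    have key : ((a : ℝ) + b + 3) * (K (b + 1) * K (a + 2)) + (2 * N + 1 - a - b) * (K b * K (a + 1))
      + (a - b - N - 1) * (K (b + 1) * K (a + 1)) - (N + 3 + a - b) * (K b * K (a + 2)) = 0 := by
      simp only [h1, h2]; push_cast; field_simp; ring
    push_cast at *
    rw [show (a : ℝ) + 2 - (b + 1) = (a : ℝ) + 1 - b by ring] at e1 d1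
    rw [show (a : ℝ) + 1 - (b + 1) = (a : ℝ) - b by ring] at e3 d3
    simp only [add_assoc, Nat.reduceAdd] at *
    linear_combination ih + (a + b + 3) * e1 + (2 * N + 1 - a - b : ℝ) * e2
      - 2 * Real.cos θ * (N + 1) * e3 + 2 * Real.sin θ * d3
      + (a - b : ℝ) * (((N + 1).choose (b + 1) : ℝ) * ((N + 1).choose (a + 1) : ℝ)) * hc4
      - (N + 1) * (((N + 1).choose (b + 1) : ℝ) * ((N + 1).choose (a + 1) : ℝ)) * hc1
      + Real.sin (((a : ℝ) + 1 - b) * θ) * key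

/-- This and the three identities after it are, up to binomial factors, the entries of
`driftE_antisymm`, `driftD_pearson`, `driftD_second` and `driftE_second`. -/
lemma sinKernel_antisymm (a b : ℕ) :
    ((a : ℝ) + 1) * T (a + 2) (b + 1) - (N + 1 - a) * T a (b + 1)
      + (b + 1) * T (a + 1) (b + 2) - (N + 1 - b) * T (a + 1) b
      - 2 * Real.cos θ * (N - a - b) * T (a + 1) (b + 1) = 0 := by
  have e := sinKernel_succ N θ a b
  have e3 := sinKernel_succ N θ (a + 1) (b + 1)
  have h := sinKernel_reduced_antisymm N θ a b
  have h2 := choose_succ_eq_div (N + 1) a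
  have h1 := choose_succ_eq_div (N + 1) b
  have key : ((b : ℝ) + 1) * (K (b + 1) * K (a + 1)) - (N + 1 - a) * (K b * K a)
      - (N - a - b) * (K b * K (a + 1)) = 0 := by
    simp only [h1, h2]; push_cast; field_simp; ring
  push_cast at *
  rw [show (a : ℝ) + 1 - (b + 1) = (a : ℝ) - b by ring] at e3
  linear_combination h + (b + 1 : ℝ) * e3 - (N + 1 - a : ℝ) * e + Real.sin ((a - b) * θ) * key

lemma sinKernel_pearson (a b : ℕ) :
    ((a : ℝ) + 1) * T (a + 2) (b + 1) + (N + 1 - a) * T a (b + 1)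
      + (b + 1) * T (a + 1) (b + 2) + (N + 1 - b) * T (a + 1) b
      - 2 * Real.cos θ * (N + 1) * T (a + 1) (b + 1)
      + 2 * Real.sin θ * sinKernelDeriv N θ (a + 1) (b + 1) = 0 := by
  have e := sinKernel_succ N θ a b
  have e3 := sinKernel_succ N θ (a + 1) (b + 1)
  have h := sinKernelDeriv_reduced_pearson N θ a b
  have h2 := choose_succ_eq_div (N + 1) a
  have h1 := choose_succ_eq_div (N + 1) b
  have key : ((b : ℝ) + 1) * (K (b + 1) * K (a + 1)) + (N + 1 - a) * (K b * K a)
      - (N + 2 + a - b) * (K b * K (a + 1)) = 0 := by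
    simp only [h1, h2]; push_cast; field_simp; ring
  push_cast at *
  rw [show (a : ℝ) + 1 - (b + 1) = (a : ℝ) - b by ring] at e3
  linear_combination h + (b + 1 : ℝ) * e3 + (N + 1 - a : ℝ) * e + Real.sin ((a - b) * θ) * key

lemma sinKernelDeriv_second_order (a b : ℕ) :
    ((b : ℝ) + 1) * sinKernelDeriv N θ (a + 1) (b + 2) + (N + 1 - b) * sinKernelDeriv N θ (a + 1) b
      - (a + 1) * sinKernelDeriv N θ (a + 2) (b + 1) - (N + 1 - a) * sinKernelDeriv N θ a (b + 1)
      + 2 * Real.sin θ * (b * (N - b) - a * (N - a)) * T (a + 1) (b + 1) = 0 := by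
  have e := sinKernelDeriv_succ N θ a b
  have e3 := sinKernelDeriv_succ N θ (a + 1) (b + 1)
  have h := sinKernelDeriv_reduced_diff N θ a b
  have h2 := choose_succ_eq_div (N + 1) a
  have h1 := choose_succ_eq_div (N + 1) b
  have key : ((b : ℝ) + 1) * (K (b + 1) * K (a + 1)) - (N + 1 - a) * (K b * K a)
      - (N - a - b) * (K b * K (a + 1)) = 0 := by
    simp only [h1, h2]; push_cast; field_simp; ring
  push_cast at *
  rw [show (a : ℝ) + 1 - (b + 1) = (a : ℝ) - b by ring] at e3
  linear_combination (b - a : ℝ) * h + (b + 1 : ℝ) * e3 - (N + 1 - a : ℝ) * e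
    + (a - b) * Real.cos ((a - b) * θ) * key

lemma sinKernelDeriv_first_order (a b : ℕ) :
    ((a : ℝ) + 1) * sinKernelDeriv N θ (a + 2) (b + 1) - (N + 1 - a) * sinKernelDeriv N θ a (b + 1)
      - Real.cos θ * (N - 2 * a) * sinKernelDeriv N θ (a + 1) (b + 1)
      + Real.sin θ * (N - 2 * a) * T (a + 1) (b + 1)
      + (N + 2) * Real.sin θ * (a - b) * T (a + 1) (b + 1) = 0 := by
  -- The differentiated antisymmetry controls the sum of the shifts in `a` and in `b`. The reduced
  -- identity, times `a - b`, controls their difference; half of each isolates the shifts in `a`.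
  have hd : ((a : ℝ) + 1) * sinKernelDeriv N θ (a + 2) (b + 1)
      - (N + 1 - a) * sinKernelDeriv N θ a (b + 1)
      + (b + 1) * sinKernelDeriv N θ (a + 1) (b + 2) - (N + 1 - b) * sinKernelDeriv N θ (a + 1) b
      - (2 * (-Real.sin θ * (N - a - b)) * T (a + 1) (b + 1) +
        2 * (Real.cos θ * (N - a - b)) * sinKernelDeriv N θ (a + 1) (b + 1)) = 0 := by
    have h1 := ((((hasDerivAt_sinKernel N (a + 2) (b + 1) θ).const_mul ((a : ℝ) + 1)).sub
      ((hasDerivAt_sinKernel N a (b + 1) θ).const_mul ((N : ℝ) + 1 - a))).add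
      ((hasDerivAt_sinKernel N (a + 1) (b + 2) θ).const_mul ((b : ℝ) + 1))).sub
      ((hasDerivAt_sinKernel N (a + 1) b θ).const_mul ((N : ℝ) + 1 - b))
    have h2 := h1.sub ((((Real.hasDerivAt_cos θ).mul_const ((N : ℝ) - a - b)).const_mul 2).mul
      (hasDerivAt_sinKernel N (a + 1) (b + 1) θ))
    refine h2.unique ((hasDerivAt_const θ (0 : ℝ)).congr_of_eventuallyEq
      (Filter.Eventually.of_forall fun t => ?_))
    have := sinKernel_antisymm N t a b
    simp only [Pi.add_apply, Pi.sub_apply, Pi.mul_apply]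
    linear_combination this
  have e := sinKernelDeriv_succ N θ a b
  have e3 := sinKernelDeriv_succ N θ (a + 1) (b + 1)
  have h := sinKernelDeriv_reduced_antisymm N θ a b
  have h2 := choose_succ_eq_div (N + 1) a
  have h1 := choose_succ_eq_div (N + 1) b
  have key : ((b : ℝ) + 1) * (K (b + 1) * K (a + 1)) + (N + 1 - a) * (K b * K a)
      - (N + 2 + a - b) * (K b * K (a + 1)) = 0 := by
    simp only [h1, h2]; push_cast; field_simp; ring
  push_cast at *
  rw [show (a : ℝ) + 1 - (b + 1) = (a : ℝ) - b by ring] at e3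
  linear_combination hd / 2 + (a - b : ℝ) / 2 * h - (b + 1 : ℝ) / 2 * e3
    - (N + 1 - a : ℝ) / 2 * e - (a - b) * Real.cos ((a - b) * θ) / 2 * key

end Identities
/-! ### The weight at `cos θ` -/

lemma poch_succ_left (a : ℝ) (k : ℕ) : poch a (k + 1) = a * poch (a + 1) k := by
  simp [poch, ascPochhammer_succ_left, Polynomial.eval_comp]

lemma poch_succ (a : ℝ) (k : ℕ) : poch a (k + 1) = poch a k * (a + k) := by
  simp [poch, ascPochhammer_succ_right]

lemma poch_zero (a : ℝ) : poch a 0 = 1 := by simp [poch]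

lemma poch_pos (a : ℝ) (ha : 0 < a) (k : ℕ) : 0 < poch a k := ascPochhammer_pos k a ha

lemma choose_mul_poch (N n k : ℕ) :
    ((N + 1).choose (n + 1) : ℝ) * ((-1) ^ k * poch ((n : ℝ) - N) k) =
      ((N + 1).choose (n + 1 + k) : ℝ) * poch ((n : ℝ) + 2) k := by
  induction k with
  | zero => simp [poch_zero]
  | succ k ih =>
    have h := choose_succ_eq_div (N + 1) (n + 1 + k)
    rw [← add_assoc, h, poch_succ, poch_succ, pow_succ]
    push_cast
    field_simp
    linear_combination (-((n : ℝ) - N + k)) * (n + 1 + k + 1) * ih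

lemma poch_div_factorial (N t : ℕ) :
    poch ((N : ℝ) + 2 - t) t / (t.factorial : ℝ) = ((N + 1).choose t : ℝ) := by
  induction t with
  | zero => simp [poch_zero]
  | succ t ih =>
    rw [choose_succ_eq_div, ← ih, poch_succ_left, Nat.factorial_succ]
    have : (t.factorial : ℝ) ≠ 0 := by positivity
    push_cast
    rw [show (N : ℝ) + 2 - (t + 1) + 1 = N + 2 - t by ring]
    field_simp
    ring

/-- The Pochhammer quotients collapse to a product of two binomial coefficients of `N + 1`; this is
what links the weight to `sinKernel`. -/
lemma weightCoeff_eq (N t m n : ℕ) (htm : t ≤ m) (hmn : m ≤ n) (hn : n ≤ N) :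
    weightCoeff N t m n = ((N + 1).choose t : ℝ) * ((N + 1).choose (n + m + 1 - t) : ℝ) /
      ((N.choose n : ℝ) * (N.choose m : ℝ)) := by
  have h1 := choose_mul_poch N n (m - t)
  rw [show n + 1 + (m - t) = n + m + 1 - t by omega] at h1
  have hp := (poch_pos ((n : ℝ) + 2) (by positivity) (m - t)).ne'
  have hN : (N.choose n : ℝ) ≠ 0 := by exact_mod_cast (Nat.choose_pos hn).ne'
  have hM : (N.choose m : ℝ) ≠ 0 := by exact_mod_cast (Nat.choose_pos (hmn.trans hn)).ne'
  have h2 : ((N + 1).choose (n + 1) : ℝ) * (n + 1) = (N + 1) * (N.choose n : ℝ) := by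
    exact_mod_cast (Nat.add_one_mul_choose_eq N n).symm
  have h3 : (N.choose m : ℝ) * m.factorial * (N - m).factorial = N.factorial := by
    exact_mod_cast Nat.choose_mul_factorial_mul_factorial (hmn.trans hn)
  have h4 : (N.factorial : ℝ) ≠ 0 := by positivity
  rw [weightCoeff, poch_div_factorial]
  have h5 : ((N - m).factorial : ℝ) * (m.factorial : ℝ) / (N.factorial : ℝ) = 1 / N.choose m := by
    rw [← h3]
    have : (m.factorial : ℝ) ≠ 0 := by positivity
    have : ((N - m).factorial : ℝ) ≠ 0 := by positivity
    field_simp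
  have h6 : ((N : ℝ) + 1) / (n + 1) = ((N + 1).choose (n + 1) : ℝ) / N.choose n := by
    rw [div_eq_div_iff (by positivity) hN]; linear_combination -h2
  rw [h5, h6]
  field_simp
  linear_combination ((N + 1).choose t : ℝ) * h1

/-- On `[0, π]` the square root is `sin θ`, and `sin θ · U_k(cos θ) = sin ((k + 1) θ)`. -/
lemma weightLower_cos (N n m : ℕ) (hmn : m ≤ n) (hn : n ≤ N) (θ : ℝ)
    (hθ : θ ∈ Set.Icc 0 Real.pi) : weightLower N n m (Real.cos θ) =
      sinKernel N θ (n + 1) (m + 1) / ((N.choose n : ℝ) * (N.choose m : ℝ)) := by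
  have hs : Real.sqrt (1 - Real.cos θ ^ 2) = Real.sin θ := by
    rw [← Real.sin_sq, Real.sqrt_sq (Real.sin_nonneg_of_mem_Icc hθ)]
  rw [weightLower, hs, sinKernel_eq_sum, Finset.mul_sum, Finset.sum_div]
  refine Finset.sum_congr rfl fun t ht => ?_
  have htm : t ≤ m := by simpa [Nat.lt_succ_iff] using ht
  have hU := Polynomial.Chebyshev.U_real_cos θ ((n : ℤ) + (m : ℤ) - 2 * (t : ℤ))
  push_cast at hU
  rw [weightCoeff_eq N t m n htm hmn hn,
    show ((n : ℝ) + m + 1 - 2 * t) * θ = ((n : ℝ) + m - 2 * t + 1) * θ by ring, ← hU]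
  ring

/-- The weight as a function of `θ`, where `x = cos θ`. -/
def angularWeight (N : ℕ) (θ : ℝ) : Mat N := Matrix.of fun p q =>
  ((sinKernel N θ ((p : ℕ) + 1) ((q : ℕ) + 1) /
    ((N.choose (p : ℕ) : ℝ) * (N.choose (q : ℕ) : ℝ)) : ℝ) : ℂ)

lemma weight_cos (N : ℕ) (θ : ℝ) (hθ : θ ∈ Set.Icc 0 Real.pi) :
    weight N (Real.cos θ) = angularWeight N θ := by
  ext p q
  simp only [weight, angularWeight, Matrix.of_apply]
  congr 1
  rcases le_total (q : ℕ) (p : ℕ) with h | h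
  · rw [max_eq_left h, min_eq_right h, weightLower_cos N _ _ h (by omega) θ hθ]
  · rw [max_eq_right h, min_eq_left h, weightLower_cos N _ _ h (by omega) θ hθ, sinKernel_comm,
      mul_comm (N.choose (q : ℕ) : ℝ)]

lemma continuous_weight (N : ℕ) : Continuous (weight N) := by
  refine continuous_matrix fun p q => Complex.continuous_ofReal.comp ?_
  unfold weightLower
  fun_prop

/-! ### The matrices of the operators and the symmetry equations -/

/-- The matrix with entries `2ℓ - i` above the diagonal. -/
def raiseMat (N : ℕ) : Mat N := Matrix.of fun i j =>
  if (j : ℕ) = (i : ℕ) + 1 then (N : ℂ) - (i : ℕ) else 0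

/-- The matrix with entries `i` below the diagonal. -/
def lowerMat (N : ℕ) : Mat N := Matrix.of fun i j =>
  if (i : ℕ) = (j : ℕ) + 1 then ((i : ℕ) : ℂ) else 0

/-- The diagonal matrix with entries `2ℓ - 2i`. -/
def wtMat (N : ℕ) : Mat N := Matrix.diagonal fun i => (N : ℂ) - 2 * (i : ℕ)

lemma matC_eq (N : ℕ) :
    matC N = (((N : ℂ) + 3) / 2) • (1 : Mat N) - (1 / 2 : ℂ) • (raiseMat N + lowerMat N) := by
  ext i j
  simp only [matC, raiseMat, lowerMat, Matrix.of_apply, Matrix.sub_apply, Matrix.smul_apply,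
    Matrix.add_apply, Matrix.one_apply, smul_eq_mul, Fin.ext_iff]
  split_ifs <;> first | omega | ring

lemma matB0_eq (N : ℕ) :
    matB0 N = (1 / (2 * N) : ℂ) • (wtMat N - raiseMat N + lowerMat N) := by
  ext i j
  simp only [matB0, wtMat, raiseMat, lowerMat, Matrix.of_apply, Matrix.sub_apply,
    Matrix.smul_apply, Matrix.add_apply, Matrix.diagonal_apply, smul_eq_mul, Fin.ext_iff]
  rcases eq_or_ne (N : ℂ) 0 with h | h
  · split_ifs <;> first | omega | simp [h]
  · split_ifs <;> first | omega | (field_simp; try ring)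

lemma matB1_eq (N : ℕ) : matB1 N = (-(1 / N) : ℂ) • wtMat N := by
  ext i j
  simp only [matB1, wtMat, Matrix.smul_apply, Matrix.diagonal_apply, smul_eq_mul]
  rcases eq_or_ne (N : ℂ) 0 with h | h
  · split_ifs <;> simp [h]
  · split_ifs
    · field_simp
    · simp

lemma sum_raiseMat {N : ℕ} (p : Fin (N + 1)) (f : ℕ → ℂ) :
    ∑ k, raiseMat N p k * f (k : ℕ) = ((N : ℂ) - (p : ℕ)) * f ((p : ℕ) + 1) := by
  simp only [raiseMat, Matrix.of_apply, ite_mul, zero_mul]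
  rcases Nat.lt_or_ge (p : ℕ) N with h | h
  · rw [Finset.sum_eq_single (⟨(p : ℕ) + 1, by omega⟩ : Fin (N + 1))]
    · simp
    · intro b _ hb
      rw [if_neg]
      exact fun h' => hb (Fin.ext h')
    · simp
  · have hp : (p : ℕ) = N := by omega
    rw [Finset.sum_eq_zero]
    · simp [hp]
    · intro b _
      rw [if_neg]
      omega

lemma sum_lowerMat {N : ℕ} (p : Fin (N + 1)) (f : ℕ → ℂ) :
    ∑ k, lowerMat N p k * f (k : ℕ) = ((p : ℕ) : ℂ) * f ((p : ℕ) - 1) := by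
  simp only [lowerMat, Matrix.of_apply, ite_mul, zero_mul]
  rcases Nat.eq_zero_or_pos (p : ℕ) with h | h
  · rw [Finset.sum_eq_zero]
    · simp [h]
    · intro b _
      rw [if_neg]
      omega
  · rw [Finset.sum_eq_single (⟨(p : ℕ) - 1, by omega⟩ : Fin (N + 1))]
    · rw [if_pos (by simp; omega)]
    · intro b _ hb
      rw [if_neg]
      exact fun h' => hb (Fin.ext (by simp; omega))
    · simp

/-- The matrix with entries `f (p + 1) (q + 1)`, divided by binomial coefficients. -/
def kernelMat (N : ℕ) (f : ℕ → ℕ → ℝ) : Mat N := Matrix.of fun p q =>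
  (f ((p : ℕ) + 1) ((q : ℕ) + 1) : ℂ) / ((N.choose (p : ℕ) : ℂ) * (N.choose (q : ℕ) : ℂ))

lemma kernelMat_conjTranspose (N : ℕ) (f : ℕ → ℕ → ℝ) (hs : ∀ a b, f a b = f b a) :
    (kernelMat N f)ᴴ = kernelMat N f := by
  ext p q
  simp only [kernelMat, Matrix.conjTranspose_apply, Matrix.of_apply, star_div₀, star_mul',
    Complex.star_def, Complex.conj_ofReal, map_natCast, hs ((q : ℕ) + 1)]
  ring

/-- The binomial denominators turn the factor `N - p` into `p + 1`. In the last row, `p = N`, the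
product is zero, and `hf` makes the right side agree. -/
lemma raiseMat_mul_kernelMat (N : ℕ) (f : ℕ → ℕ → ℝ) (hf : ∀ b, f (N + 2) b = 0)
    (p q : Fin (N + 1)) : (raiseMat N * kernelMat N f) p q =
      (((p : ℕ) : ℂ) + 1) * f ((p : ℕ) + 2) ((q : ℕ) + 1) /
        ((N.choose (p : ℕ) : ℂ) * (N.choose (q : ℕ) : ℂ)) := by
  rw [Matrix.mul_apply]
  have h := sum_raiseMat p (fun k => (f (k + 1) ((q : ℕ) + 1) : ℂ) /
    ((N.choose k : ℂ) * (N.choose (q : ℕ) : ℂ)))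
  simp only [kernelMat, Matrix.of_apply]
  rw [h]
  rcases Nat.lt_or_ge (p : ℕ) N with hp | hp
  · have h0 : (N.choose (p : ℕ) : ℂ) ≠ 0 := by exact_mod_cast (Nat.choose_pos hp.le).ne'
    have h1 : (N.choose ((p : ℕ) + 1) : ℂ) ≠ 0 := by exact_mod_cast (Nat.choose_pos hp).ne'
    have hq : (N.choose (q : ℕ) : ℂ) ≠ 0 := by
      exact_mod_cast (Nat.choose_pos (Nat.lt_succ_iff.mp q.2)).ne'
    have h2 : (N.choose ((p : ℕ) + 1) : ℂ) * ((p : ℕ) + 1) =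
        N.choose (p : ℕ) * ((N : ℂ) - (p : ℕ)) := by
      rw [← Nat.cast_sub hp.le]
      exact_mod_cast Nat.choose_succ_right_eq N p
    field_simp
    linear_combination -(f ((p : ℕ) + 2) ((q : ℕ) + 1) : ℂ) * h2
  · have hp : (p : ℕ) = N := by omega
    simp [hp, hf]

lemma lowerMat_mul_kernelMat (N : ℕ) (f : ℕ → ℕ → ℝ) (hf : ∀ b, f 0 b = 0)
    (p q : Fin (N + 1)) : (lowerMat N * kernelMat N f) p q =
      ((N : ℂ) + 1 - (p : ℕ)) * f (p : ℕ) ((q : ℕ) + 1) /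
        ((N.choose (p : ℕ) : ℂ) * (N.choose (q : ℕ) : ℂ)) := by
  rw [Matrix.mul_apply]
  have h := sum_lowerMat p (fun k => (f (k + 1) ((q : ℕ) + 1) : ℂ) /
    ((N.choose k : ℂ) * (N.choose (q : ℕ) : ℂ)))
  simp only [kernelMat, Matrix.of_apply]
  rw [h]
  obtain ⟨p, hp⟩ := p
  rcases p with _ | p
  · simp [hf]
  · have h0 : (N.choose p : ℂ) ≠ 0 := by exact_mod_cast (Nat.choose_pos (by omega)).ne'
    have h1 : (N.choose (p + 1) : ℂ) ≠ 0 := by exact_mod_cast (Nat.choose_pos (by omega)).ne'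
    have hq : (N.choose (q : ℕ) : ℂ) ≠ 0 := by
      exact_mod_cast (Nat.choose_pos (Nat.lt_succ_iff.mp q.2)).ne'
    have h2 : (N.choose (p + 1) : ℂ) * (p + 1) = N.choose p * ((N : ℂ) - p) := by
      rw [← Nat.cast_sub (by omega)]
      exact_mod_cast Nat.choose_succ_right_eq N p
    simp only [Nat.add_sub_cancel]
    push_cast
    field_simp
    linear_combination (f (p + 1) ((q : ℕ) + 1) : ℂ) * h2

lemma kernelMat_mul_raiseMat (N : ℕ) (f : ℕ → ℕ → ℝ) (hs : ∀ a b, f a b = f b a)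
    (hf : ∀ b, f (N + 2) b = 0) (p q : Fin (N + 1)) :
    (kernelMat N f * (raiseMat N)ᴴ) p q =
      (((q : ℕ) : ℂ) + 1) * f ((p : ℕ) + 1) ((q : ℕ) + 2) /
        ((N.choose (p : ℕ) : ℂ) * (N.choose (q : ℕ) : ℂ)) := by
  rw [← kernelMat_conjTranspose N f hs, ← Matrix.conjTranspose_mul, Matrix.conjTranspose_apply,
    raiseMat_mul_kernelMat N f hf]
  simp [hs ((q : ℕ) + 2), mul_comm]

lemma kernelMat_mul_lowerMat (N : ℕ) (f : ℕ → ℕ → ℝ) (hs : ∀ a b, f a b = f b a)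
    (hf : ∀ b, f 0 b = 0) (p q : Fin (N + 1)) :
    (kernelMat N f * (lowerMat N)ᴴ) p q =
      ((N : ℂ) + 1 - (q : ℕ)) * f ((p : ℕ) + 1) (q : ℕ) /
        ((N.choose (p : ℕ) : ℂ) * (N.choose (q : ℕ) : ℂ)) := by
  rw [← kernelMat_conjTranspose N f hs, ← Matrix.conjTranspose_mul, Matrix.conjTranspose_apply,
    lowerMat_mul_kernelMat N f hf]
  simp [hs (q : ℕ), mul_comm]

lemma sinKernel_left_zero (N : ℕ) (θ : ℝ) (b : ℕ) : sinKernel N θ 0 b = 0 := by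
  rw [sinKernel_comm, sinKernel_zero]

/-- Index identities of the kernel pass to its derivative by uniqueness of derivatives, with no
second induction. -/
lemma sinKernelDeriv_congr {N a b c d : ℕ} (h : ∀ t, sinKernel N t a b = sinKernel N t c d)
    (θ : ℝ) : sinKernelDeriv N θ a b = sinKernelDeriv N θ c d :=
  (hasDerivAt_sinKernel N a b θ).unique ((funext h : (fun t => sinKernel N t a b) = _) ▸
    hasDerivAt_sinKernel N c d θ)

lemma sinKernelDeriv_comm (N : ℕ) (θ : ℝ) (a b : ℕ) :
    sinKernelDeriv N θ a b = sinKernelDeriv N θ b a :=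
  sinKernelDeriv_congr (fun t => sinKernel_comm N t a b) θ

lemma sinKernelDeriv_left_zero (N : ℕ) (θ : ℝ) (b : ℕ) : sinKernelDeriv N θ 0 b = 0 := by
  rw [sinKernelDeriv_comm, sinKernelDeriv_zero]

lemma sinKernelDeriv_eq_zero_of_lt (N : ℕ) (θ : ℝ) (a b : ℕ) (h : N + 1 < a) :
    sinKernelDeriv N θ a b = 0 := by
  rw [← sinKernelDeriv_zero N θ 0]
  exact sinKernelDeriv_congr (fun t => by
    rw [sinKernel_eq_zero_of_lt N t a b h, sinKernel_zero]) θ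

lemma angularWeight_eq (N : ℕ) (θ : ℝ) : angularWeight N θ = kernelMat N (sinKernel N θ) := by
  ext p q
  simp [angularWeight, kernelMat]

/-- The derivative of `angularWeight`. -/
def angularWeightDeriv (N : ℕ) (θ : ℝ) : Mat N := kernelMat N (sinKernelDeriv N θ)

lemma angularWeight_conjTranspose (N : ℕ) (θ : ℝ) :
    (angularWeight N θ)ᴴ = angularWeight N θ := by
  rw [angularWeight_eq, kernelMat_conjTranspose N _ (sinKernel_comm N θ)]

lemma hasDerivAt_angularWeight_apply (N : ℕ) (θ : ℝ) (p q : Fin (N + 1)) :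
    HasDerivAt (fun t => angularWeight N t p q) (angularWeightDeriv N θ p q) θ := by
  simp only [angularWeight_eq, angularWeightDeriv, kernelMat, Matrix.of_apply]
  exact (hasDerivAt_sinKernel N _ _ θ).ofReal_comp.div_const _

/-- The coefficient of the first derivative, at `x = cos θ`. -/
def driftD (N : ℕ) (θ : ℝ) : Mat N :=
  raiseMat N + lowerMat N - (((N : ℂ) + 3) * (Real.cos θ : ℂ)) • (1 : Mat N)

/-- The coefficient of the first derivative in the first order operator, at `x = cos θ`. -/
def driftE (N : ℕ) (θ : ℝ) : Mat N :=
  raiseMat N - lowerMat N - (Real.cos θ : ℂ) • wtMat N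

/-- In the variable `x`, with `b` the coefficient of the first derivative, this is `b W + W bᴴ = 2
((1 - x²) W)'`. -/
lemma driftD_pearson (N : ℕ) (θ : ℝ) :
    driftD N θ * angularWeight N θ + angularWeight N θ * (driftD N θ)ᴴ =
      -(4 * Real.cos θ : ℂ) • angularWeight N θ -
        (2 * Real.sin θ : ℂ) • angularWeightDeriv N θ := by
  ext p q
  have h := congrArg Complex.ofReal (sinKernel_pearson N θ p q)
  push_cast at h
  simp only [driftD, Matrix.add_mul, Matrix.sub_mul, Matrix.mul_add, Matrix.mul_sub,
    Matrix.conjTranspose_add, Matrix.conjTranspose_sub, Matrix.conjTranspose_smul,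
    Matrix.conjTranspose_one, Matrix.smul_mul, Matrix.mul_smul, Matrix.one_mul, Matrix.mul_one,
    Matrix.add_apply, Matrix.sub_apply, Matrix.smul_apply, angularWeight_eq, angularWeightDeriv,
    raiseMat_mul_kernelMat N _ (fun b => sinKernel_eq_zero_of_lt N θ (N + 2) b (by omega)),
    lowerMat_mul_kernelMat N _ (sinKernel_left_zero N θ),
    kernelMat_mul_raiseMat N _ (sinKernel_comm N θ)
      (fun b => sinKernel_eq_zero_of_lt N θ (N + 2) b (by omega)),
    kernelMat_mul_lowerMat N _ (sinKernel_comm N θ) (sinKernel_left_zero N θ), smul_eq_mul]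
  simp only [kernelMat, Matrix.of_apply, Complex.star_def, map_mul, map_add, Complex.conj_ofReal,
    map_natCast, map_ofNat, Complex.ofReal_cos, Complex.ofReal_sin, ← Complex.cos_conj]
  linear_combination (((N.choose (p : ℕ) : ℂ) * (N.choose (q : ℕ) : ℂ))⁻¹) * h

/-- The derivative of `W bᴴ - b W`. The part of `b` that depends on `θ` is a real scalar, so its
derivative cancels from the left side. -/
lemma driftD_second (N : ℕ) (θ : ℝ) :
    angularWeightDeriv N θ * (driftD N θ)ᴴ - driftD N θ * angularWeightDeriv N θ =
      (2 * Real.sin θ : ℂ) • (Matrix.diagonal (fun i : Fin (N + 1) =>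
          ((i : ℕ) : ℂ) * ((N : ℂ) - (i : ℕ))) * angularWeight N θ -
        angularWeight N θ * Matrix.diagonal (fun i : Fin (N + 1) =>
          ((i : ℕ) : ℂ) * ((N : ℂ) - (i : ℕ)))) := by
  ext p q
  have h := congrArg Complex.ofReal (sinKernelDeriv_second_order N θ p q)
  push_cast at h
  simp only [driftD, Matrix.add_mul, Matrix.sub_mul, Matrix.mul_add, Matrix.mul_sub,
    Matrix.conjTranspose_add, Matrix.conjTranspose_sub, Matrix.conjTranspose_smul,
    Matrix.conjTranspose_one, Matrix.smul_mul, Matrix.mul_smul, Matrix.one_mul, Matrix.mul_one,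
    Matrix.add_apply, Matrix.sub_apply, Matrix.smul_apply, angularWeight_eq, angularWeightDeriv,
    raiseMat_mul_kernelMat N _ (fun b => sinKernelDeriv_eq_zero_of_lt N θ (N + 2) b (by omega)),
    lowerMat_mul_kernelMat N _ (sinKernelDeriv_left_zero N θ),
    kernelMat_mul_raiseMat N _ (sinKernelDeriv_comm N θ)
      (fun b => sinKernelDeriv_eq_zero_of_lt N θ (N + 2) b (by omega)),
    kernelMat_mul_lowerMat N _ (sinKernelDeriv_comm N θ) (sinKernelDeriv_left_zero N θ),
    Matrix.diagonal_mul, Matrix.mul_diagonal, smul_eq_mul]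
  simp only [kernelMat, Matrix.of_apply, Complex.star_def, map_mul, map_add, Complex.conj_ofReal,
    map_natCast, map_ofNat, Complex.ofReal_cos, Complex.ofReal_sin, ← Complex.cos_conj]
  linear_combination (((N.choose (p : ℕ) : ℂ) * (N.choose (q : ℕ) : ℂ))⁻¹) * h

lemma wtMat_conjTranspose (N : ℕ) : (wtMat N)ᴴ = wtMat N := by
  rw [wtMat, Matrix.diagonal_conjTranspose]
  congr 1
  ext i
  simp

lemma driftE_antisymm (N : ℕ) (θ : ℝ) :
    driftE N θ * angularWeight N θ + angularWeight N θ * (driftE N θ)ᴴ = 0 := by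
  ext p q
  have h := congrArg Complex.ofReal (sinKernel_antisymm N θ p q)
  push_cast at h
  simp only [driftE, Matrix.sub_mul, Matrix.mul_sub, Matrix.conjTranspose_sub,
    Matrix.conjTranspose_smul,
    wtMat_conjTranspose, Matrix.smul_mul, Matrix.mul_smul,
    Matrix.add_apply, Matrix.sub_apply, Matrix.smul_apply, angularWeight_eq,
    raiseMat_mul_kernelMat N _ (fun b => sinKernel_eq_zero_of_lt N θ (N + 2) b (by omega)),
    lowerMat_mul_kernelMat N _ (sinKernel_left_zero N θ),
    kernelMat_mul_raiseMat N _ (sinKernel_comm N θ)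
      (fun b => sinKernel_eq_zero_of_lt N θ (N + 2) b (by omega)),
    kernelMat_mul_lowerMat N _ (sinKernel_comm N θ) (sinKernel_left_zero N θ), smul_eq_mul]
  simp only [wtMat, Matrix.diagonal_mul, Matrix.mul_diagonal, kernelMat, Matrix.of_apply,
    Complex.star_def, Complex.conj_ofReal, Matrix.zero_apply, Complex.ofReal_cos,
    ← Complex.cos_conj]
  linear_combination (((N.choose (p : ℕ) : ℂ) * (N.choose (q : ℕ) : ℂ))⁻¹) * h

/-- For the first order operator a one-sided identity holds; subtracting it from its adjoint gives
the symmetry equation `driftE_second_symm`. -/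
lemma driftE_second (N : ℕ) (θ : ℝ) :
    driftE N θ * angularWeightDeriv N θ + (Real.sin θ : ℂ) • (wtMat N * angularWeight N θ) =
      (Real.sin θ : ℂ) • (angularWeight N θ * Matrix.diagonal (fun i : Fin (N + 1) =>
          ((N : ℂ) + 2) * (((i : ℕ) : ℂ) - N)) -
        Matrix.diagonal (fun i : Fin (N + 1) =>
          ((N : ℂ) + 2) * (((i : ℕ) : ℂ) - N)) * angularWeight N θ) := by
  ext p q
  have h := congrArg Complex.ofReal (sinKernelDeriv_first_order N θ p q)
  push_cast at h
  simp only [driftE, Matrix.sub_mul,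
    Matrix.smul_mul, Matrix.add_apply, Matrix.sub_apply, Matrix.smul_apply, angularWeight_eq,
    angularWeightDeriv,
    raiseMat_mul_kernelMat N _ (fun b => sinKernelDeriv_eq_zero_of_lt N θ (N + 2) b (by omega)),
    lowerMat_mul_kernelMat N _ (sinKernelDeriv_left_zero N θ), smul_eq_mul]
  simp only [wtMat, Matrix.diagonal_mul, Matrix.mul_diagonal, kernelMat, Matrix.of_apply,
    Complex.ofReal_cos, Complex.ofReal_sin]
  linear_combination (((N.choose (p : ℕ) : ℂ) * (N.choose (q : ℕ) : ℂ))⁻¹) * h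

lemma driftE_second_symm (N : ℕ) (θ : ℝ) :
    angularWeightDeriv N θ * (driftE N θ)ᴴ - driftE N θ * angularWeightDeriv N θ +
      (Real.sin θ : ℂ) • (angularWeight N θ * wtMat N - wtMat N * angularWeight N θ) =
      (2 * Real.sin θ : ℂ) • (Matrix.diagonal (fun i : Fin (N + 1) =>
          ((N : ℂ) + 2) * (((i : ℕ) : ℂ) - N)) * angularWeight N θ -
        angularWeight N θ * Matrix.diagonal (fun i : Fin (N + 1) =>
          ((N : ℂ) + 2) * (((i : ℕ) : ℂ) - N))) := by
  have h := driftE_second N θ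
  have hc := congrArg Matrix.conjTranspose h
  have hZ : (Matrix.diagonal (fun i : Fin (N + 1) => ((N : ℂ) + 2) * (((i : ℕ) : ℂ) - N)))ᴴ =
      Matrix.diagonal (fun i : Fin (N + 1) => ((N : ℂ) + 2) * (((i : ℕ) : ℂ) - N)) := by
    rw [Matrix.diagonal_conjTranspose]
    congr 1
    ext i
    simp
  have hD : (angularWeightDeriv N θ)ᴴ = angularWeightDeriv N θ :=
    kernelMat_conjTranspose N _ (sinKernelDeriv_comm N θ)
  simp only [Matrix.conjTranspose_add, Matrix.conjTranspose_sub, Matrix.conjTranspose_mul,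
    Matrix.conjTranspose_smul, hZ, hD, angularWeight_conjTranspose, wtMat_conjTranspose,
    Complex.star_def, Complex.conj_ofReal] at hc
  linear_combination (norm := module) hc - h

/-! ### Symmetric differential operators -/

section Symmetry

open Polynomial

attribute [local instance] Matrix.linftyOpNormedRing Matrix.linftyOpNormedAlgebra

/-- Evaluation at a scalar as a ring homomorphism. -/
def matEvalHom (N : ℕ) (x : ℂ) : (Mat N)[X] →+* Mat N :=
  eval₂RingHom' (RingHom.id _) (Matrix.scalar (Fin (N + 1)) x)
    fun A => (Matrix.scalar_commute x (fun _ => Commute.all _ _) A).symm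

lemma matEval_eq_hom {N : ℕ} (P : (Mat N)[X]) (x : ℂ) : matEval P x = matEvalHom N x P := rfl

lemma matEval_add {N : ℕ} (P Q : (Mat N)[X]) (x : ℂ) :
    matEval (P + Q) x = matEval P x + matEval Q x := map_add (matEvalHom N x) P Q

lemma matEval_mul {N : ℕ} (P Q : (Mat N)[X]) (x : ℂ) :
    matEval (P * Q) x = matEval P x * matEval Q x := map_mul (matEvalHom N x) P Q

lemma matEval_C {N : ℕ} (A : Mat N) (x : ℂ) : matEval (C A) x = A := by
  simp [matEval]

lemma matEval_X {N : ℕ} (x : ℂ) : matEval (X : (Mat N)[X]) x = x • (1 : Mat N) := by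
  simp [matEval, Matrix.smul_one_eq_diagonal]

lemma matEval_monomial {N : ℕ} (k : ℕ) (A : Mat N) (x : ℂ) :
    matEval (monomial k A) x = x ^ k • A := by
  rw [← C_mul_X_pow_eq_monomial, matEval_mul, matEval_C, matEval_eq_hom, map_pow, ← matEval_eq_hom,
    matEval_X, _root_.smul_pow, one_pow, Matrix.mul_smul, Matrix.mul_one]

lemma matEval_eq_sum {N : ℕ} (P : (Mat N)[X]) (x : ℂ) :
    matEval P x = ∑ k ∈ Finset.range (P.natDegree + 1), x ^ k • P.coeff k := by
  conv_lhs => rw [P.as_sum_range' (P.natDegree + 1) (Nat.lt_succ_self _)]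
  rw [matEval_eq_hom, map_sum]
  exact Finset.sum_congr rfl fun k _ => matEval_monomial k _ x

lemma continuous_matEval {N : ℕ} (P : (Mat N)[X]) : Continuous fun x : ℝ => matEval P (x : ℂ) := by
  simp only [matEval_eq_sum]
  fun_prop

/-- The operator `P ↦ κ (1 - x²) P'' + P' (S + x H) + P Z`. -/
def diffOp {N : ℕ} (κ : ℝ) (S H Z : Mat N) (P : (Mat N)[X]) : (Mat N)[X] :=
  derivative (derivative P) * (C ((κ : ℂ) • (1 : Mat N)) * (1 - X ^ 2)) +
    derivative P * (C S + C H * X) + P * C Z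

lemma matEval_diffOp {N : ℕ} (κ : ℝ) (S H Z : Mat N) (P : (Mat N)[X]) (x : ℂ) :
    matEval (diffOp κ S H Z P) x =
      (κ * (1 - x ^ 2) : ℂ) • matEval (derivative (derivative P)) x +
      matEval (derivative P) x * (S + x • H) + matEval P x * Z := by
  have h1 : matEval (1 - X ^ 2 : (Mat N)[X]) x = (1 - x ^ 2) • (1 : Mat N) := by
    rw [matEval_eq_hom, map_sub, map_one, map_pow, ← matEval_eq_hom, matEval_X, _root_.smul_pow,
      one_pow]
    module
  simp only [diffOp, matEval_add, matEval_mul, matEval_C, matEval_X, h1, mul_smul_comm, mul_one,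
    smul_smul,
    mul_comm (κ : ℂ)]

lemma hasDerivAt_matEval_cos {N : ℕ} (P : (Mat N)[X]) (θ : ℝ) :
    HasDerivAt (fun t : ℝ => matEval P (Real.cos t : ℂ))
      ((-Real.sin θ : ℂ) • matEval (derivative P) (Real.cos θ : ℂ)) θ := by
  induction P using Polynomial.induction_on' with
  | add P Q hP hQ =>
    simp only [matEval_add, derivative_add, smul_add]
    exact hP.add hQ
  | monomial k A =>
    simp only [matEval_monomial, derivative_monomial]
    have h1 : HasDerivAt (fun t : ℝ => (Real.cos t : ℂ)) (-Real.sin θ : ℂ) θ := by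
      simpa using (Real.hasDerivAt_cos θ).ofReal_comp
    have h2 := (h1.pow k).smul_const A
    refine h2.congr_deriv ?_
    rw [← nsmul_eq_mul', smul_smul, ← Nat.cast_smul_eq_nsmul ℂ, smul_smul]
    congr 1
    ring

lemma hasDerivAt_matrix {N : ℕ} {f : ℝ → Mat N} {f' : Mat N} {θ : ℝ} :
    HasDerivAt f f' θ ↔ ∀ i j, HasDerivAt (fun t => f t i j) (f' i j) θ :=
  hasDerivAt_pi.trans (forall_congr' fun _ => hasDerivAt_pi)

lemma hasDerivAt_angularWeight (N : ℕ) (θ : ℝ) :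
    HasDerivAt (angularWeight N) (angularWeightDeriv N θ) θ :=
  hasDerivAt_matrix.mpr (hasDerivAt_angularWeight_apply N θ)

lemma HasDerivAt.conjTranspose {N : ℕ} {f : ℝ → Mat N} {f' : Mat N} {θ : ℝ}
    (h : HasDerivAt f f' θ) : HasDerivAt (fun t => (f t)ᴴ) f'ᴴ θ := by
  rw [hasDerivAt_matrix] at h ⊢
  exact fun i j => (h j i).star

lemma integral_comp_cos (g : ℝ → ℂ) (hg : Continuous g) :
    ∫ x in (-1 : ℝ)..1, g x = ∫ θ in (0 : ℝ)..Real.pi, (Real.sin θ : ℂ) * g (Real.cos θ) := by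
  have h := intervalIntegral.integral_deriv_smul_comp (a := 0) (b := Real.pi) (f := Real.cos)
    (f' := fun t => -Real.sin t) (g := g) (fun x _ => Real.hasDerivAt_cos x)
    (Real.continuous_sin.neg.continuousOn) hg
  rw [Real.cos_zero, Real.cos_pi] at h
  rw [intervalIntegral.integral_symm, ← h, ← intervalIntegral.integral_neg]
  simp

lemma continuous_inner_integrand {N : ℕ} (P Q : (Mat N)[X]) (i j : Fin (N + 1)) :
    Continuous fun x : ℝ => (matEval P (x : ℂ) * weight N x * (matEval Q (x : ℂ))ᴴ) i j :=
  (((continuous_matEval P).matrix_mul (continuous_weight N)).matrix_mul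
    (continuous_matEval Q).matrix_conjTranspose).matrix_elem i j

/-- Hypotheses on the coefficients that make `diffOp` symmetric with respect to the weight. -/
theorem matInner_diffOp_symm {N : ℕ} (κ : ℝ) (S H Z : Mat N)
    (h1 : ∀ θ : ℝ, (S + (Real.cos θ : ℂ) • H) * angularWeight N θ +
      angularWeight N θ * (S + (Real.cos θ : ℂ) • H)ᴴ =
      -(κ : ℂ) • ((4 * Real.cos θ : ℂ) • angularWeight N θ +
        (2 * Real.sin θ : ℂ) • angularWeightDeriv N θ))
    (h2 : ∀ θ : ℝ, angularWeightDeriv N θ * (S + (Real.cos θ : ℂ) • H)ᴴ -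
      (S + (Real.cos θ : ℂ) • H) * angularWeightDeriv N θ -
      (Real.sin θ : ℂ) • (angularWeight N θ * Hᴴ - H * angularWeight N θ) =
      (2 * Real.sin θ : ℂ) • (Z * angularWeight N θ - angularWeight N θ * Zᴴ))
    (P Q : (Mat N)[X]) :
    matInner (diffOp κ S H Z P) Q = matInner P (diffOp κ S H Z Q) := by
  set c : ℝ → ℂ := fun t => (Real.cos t : ℂ) with hc
  set s : ℝ → ℂ := fun t => (Real.sin t : ℂ) with hs
  have dc (θ : ℝ) : HasDerivAt c (-s θ) θ := by
    simpa only [Complex.ofReal_neg] using (Real.hasDerivAt_cos θ).ofReal_comp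
  have ds (θ : ℝ) : HasDerivAt s (c θ) θ := (Real.hasDerivAt_sin θ).ofReal_comp
  have hsc (θ : ℝ) : 1 - c θ ^ 2 = s θ ^ 2 := by
    have := Real.sin_sq_add_cos_sq θ
    have h := congrArg Complex.ofReal this
    push_cast at h
    simp only [hc, hs]
    push_cast
    linear_combination -h
  set W := angularWeight N
  set W' := angularWeightDeriv N
  set b : ℝ → Mat N := fun t => S + c t • H with hb
  set F : ℝ → Mat N := fun t => matEval P (c t)
  set F1 : ℝ → Mat N := fun t => matEval (derivative P) (c t)
  set F2 : ℝ → Mat N := fun t => matEval (derivative (derivative P)) (c t)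
  set G : ℝ → Mat N := fun t => (matEval Q (c t))ᴴ
  set G1 : ℝ → Mat N := fun t => (matEval (derivative Q) (c t))ᴴ
  set G2 : ℝ → Mat N := fun t => (matEval (derivative (derivative Q)) (c t))ᴴ
  -- `Ξ` is the bilinear concomitant of Green's formula: `h2` computes the derivative of `T`, and
  -- with `h1` the derivative of `Ξ` becomes `-sin θ` times the difference of the two integrands.
  set T : ℝ → Mat N := fun t => (1 / 2 : ℂ) • (W t * (b t)ᴴ - b t * W t) with hT
  set Ξ : ℝ → Mat N := fun t =>
    ((κ : ℂ) * s t ^ 2) • (F1 t * W t * G t - F t * W t * G1 t) - F t * T t * G t with hΞ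
  have dF (θ : ℝ) : HasDerivAt F ((-s θ) • F1 θ) θ := hasDerivAt_matEval_cos P θ
  have dF1 (θ : ℝ) : HasDerivAt F1 ((-s θ) • F2 θ) θ := hasDerivAt_matEval_cos (derivative P) θ
  have star_s (θ : ℝ) : star (-s θ) = -s θ := by simp [hs, ← Complex.sin_conj]
  have dG (θ : ℝ) : HasDerivAt G ((-s θ) • G1 θ) θ := by
    have := HasDerivAt.conjTranspose (hasDerivAt_matEval_cos Q θ)
    rwa [Matrix.conjTranspose_smul, star_s] at this
  have dG1 (θ : ℝ) : HasDerivAt G1 ((-s θ) • G2 θ) θ := by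
    have := HasDerivAt.conjTranspose (hasDerivAt_matEval_cos (derivative Q) θ)
    rwa [Matrix.conjTranspose_smul, star_s] at this
  have dW (θ : ℝ) : HasDerivAt W (W' θ) θ := hasDerivAt_angularWeight N θ
  have db (θ : ℝ) : HasDerivAt b ((-s θ) • H) θ := by
    exact ((dc θ).smul_const H).const_add S
  have dbH (θ : ℝ) : HasDerivAt (fun t => (b t)ᴴ) ((-s θ) • Hᴴ) θ := by
    have := HasDerivAt.conjTranspose (db θ)
    rwa [Matrix.conjTranspose_smul, star_s] at this
  have dT (θ : ℝ) : HasDerivAt T (s θ • (Z * W θ - W θ * Zᴴ)) θ := by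
    have h := (((dW θ).mul (dbH θ)).sub ((db θ).mul (dW θ))).const_smul (1 / 2 : ℂ)
    refine h.congr_deriv ?_
    have h2 : W' θ * (b θ)ᴴ - b θ * W' θ - s θ • (W θ * Hᴴ - H * W θ) =
        (2 * s θ) • (Z * W θ - W θ * Zᴴ) := h2 θ
    simp only [smul_mul_assoc, mul_smul_comm]
    linear_combination (norm := module) (1 / 2 : ℂ) • h2
  have dΞ (θ : ℝ) : HasDerivAt Ξ (-(s θ • ((matEval (diffOp κ S H Z P) (c θ)) * W θ * G θ -
      F θ * W θ * (matEval (diffOp κ S H Z Q) (c θ))ᴴ))) θ := by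
    have ha := (((dF1 θ).mul (dW θ)).mul (dG θ)).sub (((dF θ).mul (dW θ)).mul (dG1 θ))
    have h := (((ds θ).pow 2).const_mul (κ : ℂ)).smul ha
    have h' := h.sub (((dF θ).mul (dT θ)).mul (dG θ))
    refine h'.congr_deriv ?_
    have h1 : b θ * W θ + W θ * (b θ)ᴴ =
        -(κ : ℂ) • ((4 * c θ) • W θ + (2 * s θ) • W' θ) := h1 θ
    have hP : matEval (diffOp κ S H Z P) (c θ) =
        (κ * s θ ^ 2) • F2 θ + F1 θ * b θ + F θ * Z := by
      rw [matEval_diffOp, hsc]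
    have hQ : (matEval (diffOp κ S H Z Q) (c θ))ᴴ =
        (κ * s θ ^ 2) • G2 θ + (b θ)ᴴ * G1 θ + Zᴴ * G θ := by
      rw [matEval_diffOp, hsc]
      have hstar : star ((κ : ℂ) * s θ ^ 2) = κ * s θ ^ 2 := by
        simp [hs, ← Complex.sin_conj]
      change (_ + matEval (derivative Q) (c θ) * b θ + _)ᴴ = _
      rw [Matrix.conjTranspose_add, Matrix.conjTranspose_add, Matrix.conjTranspose_smul,
        Matrix.conjTranspose_mul, Matrix.conjTranspose_mul, hstar]
    have e1 := congrArg (fun M => F1 θ * M * G θ) h1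
    have e2 := congrArg (fun M => F θ * M * G1 θ) h1
    rw [hP, hQ]
    simp only [hT, Pi.mul_apply, Pi.sub_apply, Pi.pow_apply]
    generalize hbH : (b θ)ᴴ = B at *
    generalize b θ = b0 at *
    clear_value c s W W' F F1 F2 G G1 G2
    simp only [mul_add, add_mul, mul_sub, sub_mul, smul_mul_assoc, mul_smul_comm, mul_assoc,
      neg_smul, mul_neg, neg_mul] at e1 e2 ⊢
    linear_combination (norm := module) (s θ / 2) • e1 - (s θ / 2) • e2
  -- Both terms of `Ξ` contain the weight, so its vanishing at `0` and `π` removes the boundary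
  -- terms.
  have hW0 : W 0 = 0 := by
    ext p q
    simp [W, angularWeight, sinKernel_at_zero]
  have hWpi : W Real.pi = 0 := by
    ext p q
    simp [W, angularWeight, sinKernel_at_pi]
  ext i j
  rw [← sub_eq_zero]
  simp only [matInner, Matrix.of_apply]
  rw [← intervalIntegral.integral_sub
    ((continuous_inner_integrand _ _ i j).intervalIntegrable _ _)
    ((continuous_inner_integrand _ _ i j).intervalIntegrable _ _)]
  refine (integral_comp_cos _ ((continuous_inner_integrand _ _ i j).sub
    (continuous_inner_integrand _ _ i j))).trans ?_
  set g : ℝ → ℂ := fun θ => s θ * (((matEval (diffOp κ S H Z P) (c θ)) * W θ * G θ -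
      F θ * W θ * (matEval (diffOp κ S H Z Q) (c θ))ᴴ) i j) with hg
  have hcongr : ∀ θ ∈ Set.uIcc 0 Real.pi, (Real.sin θ : ℂ) *
      ((matEval (diffOp κ S H Z P) ((Real.cos θ : ℝ) : ℂ) * weight N (Real.cos θ) *
        (matEval Q ((Real.cos θ : ℝ) : ℂ))ᴴ) i j -
      (matEval P ((Real.cos θ : ℝ) : ℂ) * weight N (Real.cos θ) *
        (matEval (diffOp κ S H Z Q) ((Real.cos θ : ℝ) : ℂ))ᴴ) i j) = g θ := by
    intro θ hθ
    rw [Set.uIcc_of_le Real.pi_pos.le] at hθ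
    rw [weight_cos N θ hθ]
    rfl
  refine (intervalIntegral.integral_congr hcongr).trans ?_
  have hderiv : ∀ θ ∈ Set.uIcc 0 Real.pi, HasDerivAt (fun t => -(Ξ t i j)) (g θ) θ := by
    intro θ _
    refine ((hasDerivAt_matrix.mp (dΞ θ) i j).neg).congr_deriv ?_
    simp [hg]
  have hcW : Continuous W := continuous_iff_continuousAt.mpr fun θ => (dW θ).continuousAt
  have hcc : Continuous Real.cos := Real.continuous_cos
  have hcont : Continuous g := by
    refine (Complex.continuous_ofReal.comp Real.continuous_sin).mul (Continuous.matrix_elem ?_ i j)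
    exact ((((continuous_matEval _).comp hcc).matrix_mul hcW).matrix_mul
      ((continuous_matEval _).comp hcc).matrix_conjTranspose).sub
      ((((continuous_matEval _).comp hcc).matrix_mul hcW).matrix_mul
      ((continuous_matEval _).comp hcc).matrix_conjTranspose)
  rw [intervalIntegral.integral_eq_sub_of_hasDerivAt hderiv (hcont.intervalIntegrable _ _)]
  simp [hΞ, hT, hW0, hWpi]

/-- The second order operator `D` in the variable `x`. -/
def opD {N : ℕ} : (Mat N)[X] → (Mat N)[X] :=
  diffOp 1 (raiseMat N + lowerMat N) (-((N : ℂ) + 3) • (1 : Mat N))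
    (Matrix.diagonal fun i => ((i : ℕ) : ℂ) * ((N : ℂ) - (i : ℕ)))

/-- The first order operator `2ℓ E` in the variable `x`. -/
def opE {N : ℕ} : (Mat N)[X] → (Mat N)[X] :=
  diffOp 0 (raiseMat N - lowerMat N) (-wtMat N)
    (Matrix.diagonal fun i => ((N : ℂ) + 2) * (((i : ℕ) : ℂ) - N))

lemma matInner_opD {N : ℕ} (P Q : (Mat N)[X]) :
    matInner (opD P) Q = matInner P (opD Q) := by
  have hb (θ : ℝ) : raiseMat N + lowerMat N + (Real.cos θ : ℂ) • -((N : ℂ) + 3) • (1 : Mat N) =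
      driftD N θ := by
    rw [driftD]; module
  have hH : (-((N : ℂ) + 3) • (1 : Mat N))ᴴ = -((N : ℂ) + 3) • (1 : Mat N) := by
    simp [Matrix.conjTranspose_smul]
  have hZ : (Matrix.diagonal fun i : Fin (N + 1) => ((i : ℕ) : ℂ) * ((N : ℂ) - (i : ℕ)))ᴴ =
      Matrix.diagonal fun i : Fin (N + 1) => ((i : ℕ) : ℂ) * ((N : ℂ) - (i : ℕ)) := by
    rw [Matrix.diagonal_conjTranspose]
    congr 1
    ext i
    simp
  refine matInner_diffOp_symm _ _ _ _ (fun θ => ?_) (fun θ => ?_) P Q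
  · rw [hb, driftD_pearson, Complex.ofReal_one]
    module
  · rw [hb, hH, hZ, driftD_second, mul_smul_comm, smul_mul_assoc, mul_one, one_mul, sub_self,
      smul_zero, sub_zero]

lemma matInner_opE {N : ℕ} (P Q : (Mat N)[X]) :
    matInner (opE P) Q = matInner P (opE Q) := by
  have hb (θ : ℝ) : raiseMat N - lowerMat N + (Real.cos θ : ℂ) • -wtMat N = driftE N θ := by
    rw [driftE]; module
  have hZ : (Matrix.diagonal fun i : Fin (N + 1) => ((N : ℂ) + 2) * (((i : ℕ) : ℂ) - N))ᴴ =
      Matrix.diagonal fun i : Fin (N + 1) => ((N : ℂ) + 2) * (((i : ℕ) : ℂ) - N) := by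
    rw [Matrix.diagonal_conjTranspose]
    congr 1
    ext i
    simp
  refine matInner_diffOp_symm _ _ _ _ (fun θ => ?_) (fun θ => ?_) P Q
  · rw [hb, driftE_antisymm, Complex.ofReal_zero, neg_zero, zero_smul]
  · rw [hb, hZ, ← driftE_second_symm, Matrix.conjTranspose_neg, wtMat_conjTranspose, mul_neg,
      neg_mul]
    module

end Symmetry

/-! ### Positivity of the weight -/

section Positivity

open Polynomial

/-- The polynomial `(1 + X / e)^(n - s) (1 + e X)^s`. -/
def colPoly (n : ℕ) (e : ℂ) (s : ℕ) : ℂ[X] := (1 + C e⁻¹ * X) ^ (n - s) * (1 + C e * X) ^ s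

lemma coeff_one_add_C_mul_X_pow {R : Type*} [CommSemiring R] (a : R) (n k : ℕ) :
    ((1 + C a * X : R[X]) ^ n).coeff k = (n.choose k : R) * a ^ k := by
  have h : (1 + C a * X : R[X]) ^ n = ((1 + X : R[X]) ^ n).comp (C a * X) := by
    simp
  rw [h, comp_C_mul_X_coeff, coeff_one_add_X_pow]

/-- The Gram matrix of the coefficients of `colPoly`. -/
def colGram (N : ℕ) (e : ℂ) (p q : ℕ) : ℂ :=
  ∑ s ∈ Finset.range (N + 1), (colPoly N e s).coeff p * (colPoly N e⁻¹ s).coeff q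

/-- The generating function of `colGram`. -/
def colGramGen (N : ℕ) (e : ℂ) : ℂ[X][X] :=
  ∑ s ∈ Finset.range (N + 1), C (colPoly N e s) * (colPoly N e⁻¹ s).map C

lemma coeff_colGramGen (N : ℕ) (e : ℂ) (p q : ℕ) :
    ((colGramGen N e).coeff q).coeff p = colGram N e p q := by
  simp [colGramGen, colGram, finsetSum_coeff, coeff_C_mul, coeff_map, coeff_mul_C]

/-- With `A = (1 + x/e)(1 + ey)` and `B = (1 + ex)(1 + y/e)` the generating function is the
geometric sum of `B^s A^(N-s)`, and `B - A = (e - e⁻¹)(x - y)` telescopes it. Here `x` is the inner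
variable `C X` and `y` the outer `X`. -/
lemma colGramGen_mul (N : ℕ) (e : ℂ) :
    colGramGen N e * (X - C X) * C (C (e - e⁻¹)) =
      C ((1 + C e⁻¹ * X) ^ (N + 1)) * ((1 + C e * X) ^ (N + 1) : ℂ[X]).map C -
        C ((1 + C e * X) ^ (N + 1)) * ((1 + C e⁻¹ * X) ^ (N + 1) : ℂ[X]).map C := by
  set A : ℂ[X][X] := C (1 + C e⁻¹ * X) * (1 + C e * X : ℂ[X]).map C with hA
  set B : ℂ[X][X] := C (1 + C e * X) * (1 + C e⁻¹ * X : ℂ[X]).map C with hB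
  have hAB : B - A = -((X - C X) * C (C (e - e⁻¹))) := by
    simp only [hA, hB, Polynomial.map_add, Polynomial.map_mul, Polynomial.map_one, map_C, map_X,
      C_add, C_mul, C_sub, C_1]
    ring
  have hsum : colGramGen N e = ∑ s ∈ Finset.range (N + 1), B ^ s * A ^ (N + 1 - 1 - s) := by
    refine Finset.sum_congr rfl fun s _ => ?_
    simp only [colPoly, inv_inv, hA, hB, mul_pow, C_mul, C_pow, Polynomial.map_mul,
      Polynomial.map_pow, Nat.add_sub_cancel]
    ring
  have h := geom_sum₂_mul B A (N + 1)
  rw [← hsum, hAB] at h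
  simp only [C_pow, Polynomial.map_pow, ← mul_pow, ← hA, ← hB]
  linear_combination -h

/-- The coefficient of `x^p y^(q+1)` in `colGramGen_mul`. At `e = exp (iθ)` the right side is `2i`
times a sine, so `sin θ · colGram` obeys the recurrence of `sinKernel`. -/
lemma colGram_rec (N : ℕ) (e : ℂ) (p q : ℕ) :
    (e - e⁻¹) * (colGram N e p q - if p = 0 then 0 else colGram N e (p - 1) (q + 1)) =
      ((N + 1).choose p : ℂ) * ((N + 1).choose (q + 1) : ℂ) *
        (e⁻¹ ^ p * e ^ (q + 1) - e ^ p * e⁻¹ ^ (q + 1)) := by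
  have h := congrArg (fun f : ℂ[X][X] => (f.coeff (q + 1)).coeff p) (colGramGen_mul N e)
  simp only [coeff_mul_C, mul_sub, coeff_sub, coeff_mul_X, coeff_C_mul, coeff_map,
    coeff_one_add_C_mul_X_pow, coeff_colGramGen] at h
  rcases p with _ | p
  · simp [coeff_colGramGen] at h ⊢
    linear_combination h
  · simp [coeff_colGramGen, coeff_mul_X] at h ⊢
    linear_combination h

lemma exp_sub_inv (θ : ℝ) :
    Complex.exp (θ * Complex.I) - (Complex.exp (θ * Complex.I))⁻¹ =
      2 * Complex.I * (Real.sin θ : ℂ) := by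
  rw [← Complex.exp_neg, ← neg_mul, Complex.exp_mul_I, Complex.exp_mul_I, Complex.cos_neg,
    Complex.sin_neg, Complex.ofReal_sin]
  ring

lemma sin_mul_colGram (N : ℕ) (θ : ℝ) (p q : ℕ) :
    (Real.sin θ : ℂ) * colGram N (Complex.exp (θ * Complex.I)) p q =
      (sinKernel N θ (p + 1) (q + 1) : ℂ) := by
  have hrec (p q : ℕ) : (Real.sin θ : ℂ) * (colGram N (Complex.exp (θ * Complex.I)) p q -
      if p = 0 then 0 else colGram N (Complex.exp (θ * Complex.I)) (p - 1) (q + 1)) =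
      ((N + 1).choose p : ℂ) * ((N + 1).choose (q + 1) : ℂ) *
        (Real.sin (((q : ℝ) + 1 - p) * θ) : ℂ) := by
    have h := colGram_rec N (Complex.exp (θ * Complex.I)) p q
    have h2 := exp_sub_inv (((q : ℝ) + 1 - p) * θ)
    have h3 : Complex.exp ((((q : ℝ) + 1 - p) * θ : ℝ) * Complex.I) =
        (Complex.exp (θ * Complex.I))⁻¹ ^ p * Complex.exp (θ * Complex.I) ^ (q + 1) := by
      rw [← Complex.exp_neg, ← Complex.exp_nat_mul, ← Complex.exp_nat_mul, ← Complex.exp_add]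
      congr 1
      push_cast
      ring
    have h4 : (Complex.exp ((((q : ℝ) + 1 - p) * θ : ℝ) * Complex.I))⁻¹ =
        Complex.exp (θ * Complex.I) ^ p * (Complex.exp (θ * Complex.I))⁻¹ ^ (q + 1) := by
      rw [h3, mul_inv, inv_pow, inv_inv, inv_pow]
    rw [h4, h3] at h2
    rw [h2, exp_sub_inv] at h
    have hI : (2 * Complex.I) ≠ 0 := by simp
    refine mul_left_cancel₀ hI ?_
    linear_combination h
  induction p generalizing q with
  | zero =>
    have h := hrec 0 q
    rw [sinKernel_comm, sinKernel_succ, sinKernel_zero]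
    simp only [if_pos, sub_zero] at h
    rw [h]
    push_cast
    ring_nf
  | succ p ih =>
    have h := hrec (p + 1) q
    have h1 := ih (q + 1)
    have h2 := congrArg Complex.ofReal (sinKernel_succ N θ (p + 1) (q + 1))
    simp only [Nat.add_sub_cancel, Nat.succ_ne_zero, if_false] at h
    have h3 : Real.sin (((((p + 1 : ℕ) : ℝ)) - ((q + 1 : ℕ) : ℝ)) * θ) =
        -Real.sin (((q : ℝ) + 1 - ((p + 1 : ℕ) : ℝ)) * θ) := by
      rw [← Real.sin_neg]; push_cast; ring_nf
    rw [h3] at h2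
    rw [Complex.ofReal_add, Complex.ofReal_mul, Complex.ofReal_mul, Complex.ofReal_neg,
      Complex.ofReal_natCast, Complex.ofReal_natCast] at h2
    linear_combination h + h1 + h2

/-- When `e ≠ e⁻¹`, both `f` and `X f` are combinations of `(1 + X/e) f` and `(1 + e X) f`, and
these two multiplications send the family for `n` into the family for `n + 1`. -/
lemma X_pow_mem_span_colPoly (e : ℂ) (he : e - e⁻¹ ≠ 0) (n k : ℕ) (hk : k ≤ n) :
    (X : ℂ[X]) ^ k ∈ Submodule.span ℂ (Set.range fun s : Fin (n + 1) => colPoly n e s) := by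
  have hmul (n : ℕ) (f : ℂ[X])
      (hf : f ∈ Submodule.span ℂ (Set.range fun s : Fin (n + 1) => colPoly n e s)) :
      (1 + C e⁻¹ * X) * f ∈
          Submodule.span ℂ (Set.range fun s : Fin (n + 1 + 1) => colPoly (n + 1) e s) ∧
        (1 + C e * X) * f ∈
          Submodule.span ℂ (Set.range fun s : Fin (n + 1 + 1) => colPoly (n + 1) e s) := by
    induction hf using Submodule.span_induction with
    | mem f hf =>
      obtain ⟨s, rfl⟩ := hf
      refine ⟨Submodule.subset_span ⟨s.castSucc, ?_⟩, Submodule.subset_span ⟨s.succ, ?_⟩⟩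
      · simp only [colPoly, Fin.val_castSucc]
        rw [show n + 1 - (s : ℕ) = n - s + 1 by omega]
        ring
      · simp only [colPoly, Fin.val_succ]
        rw [show n + 1 - ((s : ℕ) + 1) = n - s by omega]
        ring
    | zero => simp
    | add f g _ _ hf hg =>
      simp only [mul_add]
      exact ⟨add_mem hf.1 hg.1, add_mem hf.2 hg.2⟩
    | smul c f _ hf =>
      simp only [mul_smul_comm]
      exact ⟨Submodule.smul_mem _ _ hf.1, Submodule.smul_mem _ _ hf.2⟩
  have he0 : e ≠ 0 := by rintro rfl; simp at he
  induction n generalizing k with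
  | zero =>
    obtain rfl : k = 0 := by omega
    exact Submodule.subset_span ⟨0, by simp [colPoly]⟩
  | succ n ih =>
    rcases Nat.lt_or_ge n k with h | h
    · obtain rfl : k = n + 1 := by omega
      obtain ⟨h1, h2⟩ := hmul n _ (ih n le_rfl)
      have h3 := Submodule.smul_mem _ (e - e⁻¹)⁻¹ (Submodule.sub_mem _ h2 h1)
      convert h3 using 1
      rw [← sub_mul, show (1 + C e * X - (1 + C e⁻¹ * X) : ℂ[X]) = C (e - e⁻¹) * X by
        rw [C_sub]; ring, smul_eq_C_mul, ← mul_assoc, ← mul_assoc, ← C_mul, inv_mul_cancel₀ he,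
        C_1, one_mul, pow_succ']
    · obtain ⟨h1, h2⟩ := hmul n _ (ih k h)
      have h3 := Submodule.smul_mem _ (e - e⁻¹)⁻¹
        (Submodule.sub_mem _ (Submodule.smul_mem _ e h1) (Submodule.smul_mem _ e⁻¹ h2))
      convert h3 using 1
      rw [← smul_mul_assoc, ← smul_mul_assoc, ← sub_mul]
      have h4 : (e • (1 + C e⁻¹ * X) - e⁻¹ • (1 + C e * X) : ℂ[X]) = C (e - e⁻¹) := by
        have h5 : C e * C e⁻¹ = (1 : ℂ[X]) := by rw [← C_mul, mul_inv_cancel₀ he0, C_1]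
        rw [smul_eq_C_mul, smul_eq_C_mul, C_sub]
        ring
      rw [h4, smul_eq_C_mul, ← mul_assoc, ← C_mul, inv_mul_cancel₀ he, C_1, one_mul]

/-- The square root of the weight at `cos θ`, up to the factor `sin θ`. -/
def colMat (N : ℕ) (e : ℂ) : Mat N := Matrix.of fun p s =>
  (colPoly N e (s : ℕ)).coeff (p : ℕ) / (N.choose (p : ℕ) : ℂ)

lemma conj_exp_mul_I (θ : ℝ) :
    (starRingEnd ℂ) (Complex.exp (θ * Complex.I)) = (Complex.exp (θ * Complex.I))⁻¹ := by
  rw [← Complex.exp_conj, ← Complex.exp_neg]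
  simp

lemma conj_coeff_colPoly (N : ℕ) (θ : ℝ) (s p : ℕ) :
    (starRingEnd ℂ) ((colPoly N (Complex.exp (θ * Complex.I)) s).coeff p) =
      (colPoly N (Complex.exp (θ * Complex.I))⁻¹ s).coeff p := by
  rw [← coeff_map]
  simp [colPoly, conj_exp_mul_I]

/-- On the unit circle `e⁻¹` is the conjugate of `e`, so the Gram sum pairing `e` with `e⁻¹` is a
matrix times its adjoint. -/
lemma angularWeight_eq_mul (N : ℕ) (θ : ℝ) : angularWeight N θ =
    Real.sin θ • (colMat N (Complex.exp (θ * Complex.I)) *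
      (colMat N (Complex.exp (θ * Complex.I)))ᴴ) := by
  ext p q
  rw [angularWeight_eq, kernelMat, Matrix.of_apply, ← sin_mul_colGram, Matrix.smul_apply,
    Matrix.mul_apply, colGram, ← Fin.sum_univ_eq_sum_range (fun s =>
      (colPoly N (Complex.exp (θ * Complex.I)) s).coeff (p : ℕ) *
      (colPoly N (Complex.exp (θ * Complex.I))⁻¹ s).coeff (q : ℕ)), Complex.real_smul,
    mul_div_assoc, Finset.sum_div]
  congr 1
  refine Finset.sum_congr rfl fun s _ => ?_
  simp only [colMat, Matrix.conjTranspose_apply, Matrix.of_apply, star_div₀, Complex.star_def,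
    conj_coeff_colPoly, map_natCast]
  ring

lemma vecMul_colMat_injective (N : ℕ) (e : ℂ) (he : e - e⁻¹ ≠ 0) :
    Function.Injective (colMat N e).vecMul := by
  have key (v : Fin (N + 1) → ℂ) (hv : v ᵥ* colMat N e = 0) : v = 0 := by
    -- The row vector is read as a functional on coefficients: it kills every `colPoly`, hence every
    -- monomial of degree at most `N`.
    let φ : ℂ[X] →ₗ[ℂ] ℂ := ∑ p : Fin (N + 1), (v p / (N.choose (p : ℕ) : ℂ)) • lcoeff ℂ (p : ℕ)
    have hφ (f : ℂ[X]) : φ f = ∑ p : Fin (N + 1), v p / (N.choose (p : ℕ) : ℂ) * f.coeff p := by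
      simp [φ, LinearMap.sum_apply]
    have hker : Submodule.span ℂ (Set.range fun s : Fin (N + 1) => colPoly N e s) ≤
        LinearMap.ker φ := by
      rw [Submodule.span_le]
      rintro _ ⟨s, rfl⟩
      have := congrFun hv s
      rw [SetLike.mem_coe, LinearMap.mem_ker, hφ]
      rw [Matrix.vecMul, dotProduct] at this
      rw [Pi.zero_apply] at this
      rw [← this]
      refine Finset.sum_congr rfl fun p _ => ?_
      simp only [colMat, Matrix.of_apply]
      ring
    ext k
    have h := hker (X_pow_mem_span_colPoly e he N (k : ℕ) (by omega))
    rw [LinearMap.mem_ker, hφ, Finset.sum_eq_single k] at h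
    · have h0 : (N.choose (k : ℕ) : ℂ) ≠ 0 := by
        exact_mod_cast (Nat.choose_pos (by omega)).ne'
      simpa [h0] using h
    · intro b _ hb
      rw [coeff_X_pow, if_neg (fun h => hb (Fin.ext h)), mul_zero]
    · simp
  intro v w h
  exact sub_eq_zero.mp (key (v - w) (by
    have h : v ᵥ* colMat N e = w ᵥ* colMat N e := h
    rw [Matrix.sub_vecMul, h, sub_self]))

theorem weight_posDef (N : ℕ) (x : ℝ) (hx : x ∈ Set.Ioo (-1 : ℝ) 1) : (weight N x).PosDef := by
  set θ := Real.arccos x with hθ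
  have hs : 0 < Real.sin θ := by
    rw [hθ, Real.sin_arccos]
    exact Real.sqrt_pos.mpr (by nlinarith [hx.1, hx.2])
  have he : Complex.exp (θ * Complex.I) - (Complex.exp (θ * Complex.I))⁻¹ ≠ 0 := by
    rw [exp_sub_inv]
    exact mul_ne_zero (by simp) (Complex.ofReal_ne_zero.mpr hs.ne')
  rw [← Real.cos_arccos hx.1.le hx.2.le, weight_cos N _
    ⟨Real.arccos_nonneg x, Real.arccos_le_pi x⟩, angularWeight_eq_mul]
  exact (Matrix.PosDef.mul_conjTranspose_self _ (vecMul_colMat_injective N _ he)).smul hs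

end Positivity

/-! ### The matrix-valued inner product -/

section Orthogonality

open Polynomial

lemma matInner_add_left {N : ℕ} (P P' Q : (Mat N)[X]) :
    matInner (P + P') Q = matInner P Q + matInner P' Q := by
  ext i j
  simp only [matInner, Matrix.of_apply, Matrix.add_apply, matEval_add, Matrix.add_mul]
  exact intervalIntegral.integral_add
    ((continuous_inner_integrand P Q i j).intervalIntegrable _ _)
    ((continuous_inner_integrand P' Q i j).intervalIntegrable _ _)

lemma matInner_C_mul_left {N : ℕ} (A : Mat N) (P Q : (Mat N)[X]) :
    matInner (C A * P) Q = A * matInner P Q := by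
  ext i j
  have h (x : ℝ) : (matEval (C A * P) (x : ℂ) * weight N x * (matEval Q (x : ℂ))ᴴ) i j =
      ∑ k, A i k * (matEval P (x : ℂ) * weight N x * (matEval Q (x : ℂ))ᴴ) k j := by
    rw [matEval_mul, matEval_C, Matrix.mul_assoc, Matrix.mul_assoc, Matrix.mul_apply,
      ← Matrix.mul_assoc]
  rw [Matrix.mul_apply]
  simp only [matInner, Matrix.of_apply, h]
  rw [intervalIntegral.integral_finsetSum]
  · refine Finset.sum_congr rfl fun k _ => ?_
    simp only [intervalIntegral.integral_const_mul]
  · intro k _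
    exact ((continuous_inner_integrand P Q k j).const_smul (A i k)).intervalIntegrable _ _

lemma weight_conjTranspose (N : ℕ) (x : ℝ) : (weight N x)ᴴ = weight N x := by
  ext i j
  simp [weight, max_comm, min_comm]

lemma matInner_conjTranspose {N : ℕ} (P Q : (Mat N)[X]) :
    (matInner P Q)ᴴ = matInner Q P := by
  ext i j
  simp only [matInner, Matrix.of_apply, Matrix.conjTranspose_apply, Complex.star_def]
  rw [intervalIntegral.integral_of_le (by norm_num), intervalIntegral.integral_of_le (by norm_num),
    ← integral_conj]
  refine MeasureTheory.integral_congr_ae (Filter.Eventually.of_forall fun x => ?_)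
  have h : (matEval P (x : ℂ) * weight N x * (matEval Q (x : ℂ))ᴴ)ᴴ =
      matEval Q (x : ℂ) * weight N x * (matEval P (x : ℂ))ᴴ := by
    simp [Matrix.conjTranspose_mul, weight_conjTranspose, Matrix.mul_assoc]
  simp only [← h, Matrix.conjTranspose_apply, Complex.star_def]

lemma matInner_sub_left {N : ℕ} (P P' Q : (Mat N)[X]) :
    matInner (P - P') Q = matInner P Q - matInner P' Q := by
  rw [eq_sub_iff_add_eq, ← matInner_add_left, sub_add_cancel]

lemma matInner_add_right {N : ℕ} (P Q Q' : (Mat N)[X]) :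
    matInner P (Q + Q') = matInner P Q + matInner P Q' := by
  rw [← matInner_conjTranspose, matInner_add_left, Matrix.conjTranspose_add,
    matInner_conjTranspose, matInner_conjTranspose]

lemma matInner_C_mul_right {N : ℕ} (A : Mat N) (P Q : (Mat N)[X]) :
    matInner P (C A * Q) = matInner P Q * Aᴴ := by
  rw [← matInner_conjTranspose, matInner_C_mul_left, Matrix.conjTranspose_mul,
    matInner_conjTranspose]

lemma matInner_zero_left {N : ℕ} (Q : (Mat N)[X]) : matInner 0 Q = 0 := by
  simpa using matInner_C_mul_left 0 0 Q

lemma matInner_sum_left {N : ℕ} {ι : Type*} (s : Finset ι) (P : ι → (Mat N)[X]) (Q : (Mat N)[X]) :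
    matInner (∑ k ∈ s, P k) Q = ∑ k ∈ s, matInner (P k) Q := by
  classical
  induction s using Finset.induction_on with
  | empty => simp [matInner_zero_left]
  | insert a s ha ih => rw [Finset.sum_insert ha, Finset.sum_insert ha, matInner_add_left, ih]

lemma quadForm_matInner {N : ℕ} (P : (Mat N)[X]) (v : Fin (N + 1) → ℂ) :
    star v ⬝ᵥ (matInner P P *ᵥ v) = ∫ x in (-1 : ℝ)..1,
      star v ⬝ᵥ ((matEval P (x : ℂ) * weight N x * (matEval P (x : ℂ))ᴴ) *ᵥ v) := by
  have hint (i j : Fin (N + 1)) : IntervalIntegrable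
      (fun x : ℝ => (matEval P (x : ℂ) * weight N x * (matEval P (x : ℂ))ᴴ) i j * v j)
      MeasureTheory.volume (-1) 1 :=
    ((continuous_inner_integrand P P i j).mul continuous_const).intervalIntegrable _ _
  simp only [dotProduct, Matrix.mulVec, matInner, Matrix.of_apply]
  rw [intervalIntegral.integral_finsetSum]
  · refine Finset.sum_congr rfl fun i _ => ?_
    rw [intervalIntegral.integral_const_mul, intervalIntegral.integral_finsetSum]
    · simp only [intervalIntegral.integral_mul_const]
    · exact fun j _ => hint i j
  · intro i _
    refine Continuous.intervalIntegrable (continuous_const.mul ?_) _ _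
    exact continuous_finsetSum _ fun j _ =>
      (continuous_inner_integrand P P i j).mul continuous_const

lemma coeff_mulVec_eq_zero {N : ℕ} (P : (Mat N)[X]) (v : Fin (N + 1) → ℂ)
    (h : ∀ x ∈ Set.Ioo (-1 : ℝ) 1, (matEval P (x : ℂ))ᴴ *ᵥ v = 0) (k : ℕ) :
    (P.coeff k)ᴴ *ᵥ v = 0 := by
  ext j
  set q : ℂ[X] := ∑ k ∈ Finset.range (P.natDegree + 1), monomial k (((P.coeff k)ᴴ *ᵥ v) j) with hq
  have hq0 : q = 0 := by
    refine eq_zero_of_infinite_isRoot q (Set.Infinite.mono ?_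
      ((Set.Ioo_infinite (show (-1 : ℝ) < 1 by norm_num)).image
        Complex.ofReal_injective.injOn))
    rintro _ ⟨x, hx, rfl⟩
    have h1 := congrFun (h x hx) j
    rw [matEval_eq_sum, Matrix.conjTranspose_sum, Matrix.sum_mulVec, Finset.sum_apply] at h1
    simp only [Matrix.conjTranspose_smul, Matrix.smul_mulVec, Pi.smul_apply, star_pow,
      Complex.star_def, Complex.conj_ofReal, Pi.zero_apply, smul_eq_mul] at h1
    rw [Set.mem_ofPred_eq, IsRoot, hq, eval_finsetSum, ← h1]
    refine Finset.sum_congr rfl fun k _ => ?_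
    rw [eval_monomial, mul_comm]
  rcases Nat.lt_or_ge P.natDegree k with hk | hk
  · simp [coeff_eq_zero_of_natDegree_lt hk]
  · have h2 := congrArg (fun f => f.coeff k) hq0
    simp only [hq, finsetSum_coeff, coeff_monomial, coeff_zero] at h2
    rw [Finset.sum_ite_eq' (Finset.range (P.natDegree + 1)) k,
      if_pos (Finset.mem_range.mpr (Nat.lt_succ_of_le hk))] at h2
    exact h2

/-- The integrand is continuous, nonnegative, and positive wherever `P(x)ᴴ v ≠ 0`; such a point
exists, as a nonzero polynomial has finitely many roots. Asking for just one coefficient with `P_kᴴ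
v ≠ 0` covers both positivity for monic `P` and definiteness of the inner product. -/
lemma quadForm_matInner_pos {N : ℕ} (P : (Mat N)[X]) (v : Fin (N + 1) → ℂ) (k : ℕ)
    (hk : (P.coeff k)ᴴ *ᵥ v ≠ 0) : 0 < star v ⬝ᵥ (matInner P P *ᵥ v) := by
  have hx : ∃ x ∈ Set.Ioo (-1 : ℝ) 1, (matEval P (x : ℂ))ᴴ *ᵥ v ≠ 0 := by
    by_contra! h
    exact hk (coeff_mulVec_eq_zero P v h k)
  obtain ⟨x₀, hx₀, hv₀⟩ := hx
  set f : ℝ → ℂ := fun x =>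
    star v ⬝ᵥ ((matEval P (x : ℂ) * weight N x * (matEval P (x : ℂ))ᴴ) *ᵥ v) with hf
  have hform (x : ℝ) : f x = star ((matEval P (x : ℂ))ᴴ *ᵥ v) ⬝ᵥ
      (weight N x *ᵥ ((matEval P (x : ℂ))ᴴ *ᵥ v)) := by
    rw [hf, Matrix.star_mulVec, Matrix.conjTranspose_conjTranspose, ← Matrix.dotProduct_mulVec,
      Matrix.mulVec_mulVec, Matrix.mulVec_mulVec]
  have hcont : Continuous f :=
    continuous_const.dotProduct ((Continuous.matrix_mulVec
      (((continuous_matEval P).matrix_mul (continuous_weight N)).matrix_mul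
        (continuous_matEval P).matrix_conjTranspose)) continuous_const)
  have hnn : ∀ x ∈ Set.Ioo (-1 : ℝ) 1, 0 ≤ f x := fun x hx => by
    rw [hform]
    exact (weight_posDef N x hx).posSemidef.dotProduct_mulVec_nonneg _
  -- Positivity of the weight is known on the open interval only; the endpoints follow by
  -- continuity.
  have hnn' : ∀ x ∈ Set.Icc (-1 : ℝ) 1, 0 ≤ f x := by
    rw [← closure_Ioo (show (-1 : ℝ) ≠ 1 by norm_num)]
    exact fun x hx => closure_minimal hnn (isClosed_le continuous_const hcont) hx
  have hre : ∀ x ∈ Set.uIcc (-1 : ℝ) 1, f x = ((f x).re : ℂ) := fun x hx => by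
    rw [Set.uIcc_of_le (by norm_num)] at hx
    exact Complex.eq_re_of_ofReal_le (hnn' x hx)
  rw [quadForm_matInner, intervalIntegral.integral_congr hre, intervalIntegral.integral_ofReal]
  rw [Complex.zero_lt_real]
  refine intervalIntegral.integral_pos (by norm_num)
    (Complex.continuous_re.comp hcont).continuousOn
    (fun x hx => (Complex.le_def.mp (hnn' x ⟨hx.1.le, hx.2⟩)).1)
    ⟨x₀, ⟨hx₀.1.le, hx₀.2.le⟩, ?_⟩
  have := (weight_posDef N x₀ hx₀).dotProduct_mulVec_pos hv₀
  rw [← hform] at this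
  exact (Complex.lt_def.mp this).1

lemma matInner_self_posDef {N : ℕ} (P : (Mat N)[X]) (hP : P.Monic) : (matInner P P).PosDef := by
  refine Matrix.PosDef.of_dotProduct_mulVec_pos (matInner_conjTranspose P P) fun v hv => ?_
  refine quadForm_matInner_pos P v P.natDegree ?_
  rw [coeff_natDegree, hP.leadingCoeff, Matrix.conjTranspose_one, Matrix.one_mulVec]
  exact hv

lemma eq_zero_of_matInner_self {N : ℕ} (P : (Mat N)[X]) (h : matInner P P = 0) : P = 0 := by
  ext1 k
  have h1 : ∀ v, (P.coeff k)ᴴ *ᵥ v = 0 := by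
    intro v
    by_contra hv
    have := quadForm_matInner_pos P v k hv
    rw [h, Matrix.zero_mulVec, dotProduct_zero] at this
    exact lt_irrefl _ this
  rw [coeff_zero, ← Matrix.conjTranspose_eq_zero]
  ext i j
  simpa using congrFun (h1 (Pi.single j 1)) i

/-! ### Existence and uniqueness of the monic orthogonal polynomials. -/

lemma matInner_eq_zero_of_degree_lt {N n : ℕ} {P : ℕ → (Mat N)[X]}
    (hdeg : ∀ m < n, (P m).natDegree = m) (hmon : ∀ m < n, (P m).Monic) (F : (Mat N)[X])
    (hF : ∀ m < n, matInner F (P m) = 0) (Q : (Mat N)[X]) (hQ : Q.degree < n) :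
    matInner F Q = 0 := by
  suffices H : ∀ d ≤ n, ∀ Q : (Mat N)[X], Q.degree < d → matInner F Q = 0 from H n le_rfl Q hQ
  intro d
  induction d with
  | zero =>
    intro _ Q hQ
    rw [Nat.cast_zero, Nat.WithBot.lt_zero_iff, degree_eq_bot] at hQ
    rw [hQ, ← matInner_conjTranspose, matInner_zero_left, Matrix.conjTranspose_zero]
  | succ d ih =>
    intro hd Q hQ
    have h1 : matInner F (Q - C (Q.coeff d) * P d) = 0 := by
      refine ih (by omega) _ ((degree_lt_iff_coeff_zero _ _).mpr fun k hk => ?_)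
      rw [coeff_sub, coeff_C_mul]
      rcases eq_or_lt_of_le hk with rfl | hk
      · have : (P d).coeff d = 1 := by
          have := (hmon d (by omega)).coeff_natDegree
          rwa [hdeg d (by omega)] at this
        rw [this, mul_one, sub_self]
      · rw [coeff_eq_zero_of_natDegree_lt (p := P d) (by rw [hdeg d (by omega)]; exact hk),
          (degree_lt_iff_coeff_zero _ _).mp hQ k hk, mul_zero, sub_zero]
    rw [← sub_add_cancel Q (C (Q.coeff d) * P d), matInner_add_right, h1, matInner_C_mul_right,
      hF d (by omega), Matrix.zero_mul, add_zero]

/-- Gram–Schmidt on the powers of `X`, with matrix coefficients on the left; the norms `⟨P_m, P_m⟩`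
are invertible because monic polynomials have positive definite norm. -/
lemma exists_orthogonal_family (N n : ℕ) : ∃ P : ℕ → (Mat N)[X], ∀ m < n,
    (P m).natDegree = m ∧ (P m).Monic ∧ ∀ k < m, matInner (P m) (P k) = 0 := by
  induction n with
  | zero => exact ⟨0, by simp⟩
  | succ n ih =>
    obtain ⟨P, hP⟩ := ih
    set S : (Mat N)[X] := ∑ m ∈ Finset.range n,
      C (matInner (X ^ n) (P m) * (matInner (P m) (P m))⁻¹) * P m with hS
    have hSdeg : S.degree < n := by
      rw [degree_lt_iff_coeff_zero]
      intro k hk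
      rw [hS, finsetSum_coeff]
      refine Finset.sum_eq_zero fun m hm => ?_
      have hm := Finset.mem_range.mp hm
      rw [coeff_C_mul, coeff_eq_zero_of_natDegree_lt (p := P m) (by rw [(hP m hm).1]; omega),
        mul_zero]
    have hmonic : (X ^ n - S).Monic := monic_X_pow_sub hSdeg
    have hdeg : (X ^ n - S).natDegree = n := by
      have h := degree_sub_eq_left_of_degree_lt (p := (X ^ n : (Mat N)[X])) (q := S)
        (by rwa [degree_X_pow])
      exact natDegree_eq_of_degree_eq_some (h.trans (degree_X_pow n))
    have horth : ∀ k < n, matInner (X ^ n - S) (P k) = 0 := by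
      intro k hk
      rw [matInner_sub_left, hS, matInner_sum_left, Finset.sum_eq_single k]
      · have := (Matrix.isUnit_iff_isUnit_det _).mp (matInner_self_posDef (P k)
          (hP k hk).2.1).isUnit
        rw [matInner_C_mul_left, Matrix.nonsing_inv_mul_cancel_right _ _ this, sub_self]
      · intro m hm hmk
        have hm := Finset.mem_range.mp hm
        rw [matInner_C_mul_left]
        rcases lt_or_gt_of_ne hmk with h | h
        · rw [← matInner_conjTranspose (P k), (hP k hk).2.2 m h, Matrix.conjTranspose_zero,
            Matrix.mul_zero]
        · rw [(hP m hm).2.2 k h, Matrix.mul_zero]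
      · intro h
        exact absurd (Finset.mem_range.mpr hk) h
    refine ⟨Function.update P n (X ^ n - S), fun m hm => ?_⟩
    rcases Nat.lt_succ_iff_lt_or_eq.mp hm with h | rfl
    · rw [Function.update_of_ne h.ne]
      refine ⟨(hP m h).1, (hP m h).2.1, fun k hk => ?_⟩
      rw [Function.update_of_ne (by omega)]
      exact (hP m h).2.2 k hk
    · rw [Function.update_self]
      refine ⟨hdeg, hmonic, fun k hk => ?_⟩
      rw [Function.update_of_ne hk.ne]
      exact horth k hk

lemma IsMonicOrthogonal.matInner_eq_zero {N : ℕ} {P : ℕ → (Mat N)[X]}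
    (hP : IsMonicOrthogonal N P) (n : ℕ) (Q : (Mat N)[X]) (hQ : Q.degree < n) :
    matInner (P n) Q = 0 :=
  matInner_eq_zero_of_degree_lt (fun m _ => hP.natDegree_eq m) (fun m _ => hP.monic m) _
    (fun m hm => hP.orthogonal n m hm.ne') Q hQ

theorem existsUnique_isMonicOrthogonal (N : ℕ) :
    ∃! P : ℕ → (Mat N)[X], IsMonicOrthogonal N P := by
  have h (n : ℕ) : ∃ F : (Mat N)[X], F.natDegree = n ∧ F.Monic ∧
      ∀ Q : (Mat N)[X], Q.degree < n → matInner F Q = 0 := by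
    obtain ⟨P, hP⟩ := exists_orthogonal_family N (n + 1)
    obtain ⟨h1, h2, h3⟩ := hP n (by omega)
    exact ⟨P n, h1, h2, matInner_eq_zero_of_degree_lt (fun m hm => (hP m (by omega)).1)
      (fun m hm => (hP m (by omega)).2.1) _ h3⟩
  choose P h1 h2 h3 using h
  have horth (n m : ℕ) (hmn : m < n) : matInner (P n) (P m) = 0 := by
    refine h3 n _ (degree_le_natDegree.trans_lt ?_)
    rw [h1]
    exact_mod_cast hmn
  refine ⟨P, ⟨h1, h2, fun n m hnm => ?_, fun n => matInner_self_posDef _ (h2 n)⟩, ?_⟩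
  · rcases lt_or_gt_of_ne hnm with h | h
    · rw [← matInner_conjTranspose, horth m n h, Matrix.conjTranspose_zero]
    · exact horth n m h
  · intro P' hP'
    ext1 n
    have hdeg : (P' n - P n).degree < n := by
      rw [degree_lt_iff_coeff_zero]
      intro k hk
      rcases eq_or_lt_of_le hk with rfl | hk
      · have e1 := (hP'.monic n).coeff_natDegree
        have e2 := (h2 n).coeff_natDegree
        rw [hP'.natDegree_eq] at e1
        rw [h1] at e2
        rw [coeff_sub, e1, e2, sub_self]
      · rw [coeff_sub, coeff_eq_zero_of_natDegree_lt (by rw [hP'.natDegree_eq]; exact hk),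
          coeff_eq_zero_of_natDegree_lt (by rw [h1]; exact hk), sub_self]
    -- Both candidates are orthogonal to everything of degree below `n`, so their difference is
    -- orthogonal to itself.
    refine sub_eq_zero.mp (eq_zero_of_matInner_self _ ?_)
    rw [matInner_sub_left, h3 n _ hdeg, hP'.matInner_eq_zero n _ hdeg, sub_self]

/-! ### Eigenvalue equations for the orthogonal polynomials. -/

lemma coeff_diffOp {N : ℕ} (κ : ℝ) (S H Z : Mat N) (P : (Mat N)[X]) (k : ℕ) :
    (diffOp κ S H Z P).coeff k =
      ((κ : ℂ) * (k + 1) * (k + 2)) • P.coeff (k + 2) - ((κ : ℂ) * k * (k - 1)) • P.coeff k +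
      ((k : ℂ) + 1) • (P.coeff (k + 1) * S) + (k : ℂ) • (P.coeff k * H) + P.coeff k * Z := by
  have hd (Q : (Mat N)[X]) (k : ℕ) :
      (derivative Q).coeff k = ((k : ℂ) + 1) • Q.coeff (k + 1) := by
    rw [coeff_derivative, ← Nat.cast_succ, ← nsmul_eq_mul', ← Nat.cast_smul_eq_nsmul ℂ]
    push_cast
    rfl
  have h1 : derivative P * (C S + C H * X) = derivative P * C S + derivative P * C H * X := by
    rw [mul_add, mul_assoc]
  have h2 : derivative (derivative P) * (C ((κ : ℂ) • (1 : Mat N)) * (1 - X ^ 2)) =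
      derivative (derivative P) * C ((κ : ℂ) • (1 : Mat N)) -
        derivative (derivative P) * C ((κ : ℂ) • (1 : Mat N)) * X ^ 2 := by
    rw [← mul_assoc, mul_sub, mul_one]
  rw [diffOp, h1, h2]
  rcases k with _ | _ | k
  · simp only [coeff_add, coeff_sub, coeff_mul_C, hd, coeff_mul_X_zero, coeff_mul_X_pow',
      smul_mul_assoc, mul_smul_comm, mul_one]
    norm_num
    module
  · simp only [coeff_add, coeff_sub, coeff_mul_C, hd, coeff_mul_X, coeff_mul_X_pow',
      smul_mul_assoc, mul_smul_comm, mul_one]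
    norm_num
    module
  · simp only [coeff_add, coeff_sub, coeff_mul_C, hd, coeff_mul_X, coeff_mul_X_pow,
      smul_mul_assoc, mul_smul_comm, mul_one]
    push_cast
    module

lemma degree_diffOp_lt {N : ℕ} (κ : ℝ) (S H Z : Mat N) (P : (Mat N)[X]) (n : ℕ)
    (hP : P.degree < n) : (diffOp κ S H Z P).degree < n := by
  rw [degree_lt_iff_coeff_zero] at hP ⊢
  intro k hk
  simp [coeff_diffOp, hP k hk, hP (k + 1) (by omega), hP (k + 2) (by omega)]

/-- The eigenvalue is read off from the leading coefficient, so the difference of the two sides has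
degree below `n`. By symmetry, and because the operator does not raise degrees, this difference is
orthogonal to itself. -/
theorem IsMonicOrthogonal.diffOp_eq {N : ℕ} {P : ℕ → (Mat N)[X]} (hP : IsMonicOrthogonal N P)
    (κ : ℝ) (S H Z : Mat N)
    (hsymm : ∀ F G : (Mat N)[X], matInner (diffOp κ S H Z F) G = matInner F (diffOp κ S H Z G))
    (n : ℕ) : diffOp κ S H Z (P n) =
      C (-((κ : ℂ) * n * (n - 1)) • (1 : Mat N) + (n : ℂ) • H + Z) * P n := by
  set Λ : Mat N := -((κ : ℂ) * n * (n - 1)) • (1 : Mat N) + (n : ℂ) • H + Z with hΛ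
  have hlt (k : ℕ) (hk : n < k) : (P n).coeff k = 0 :=
    coeff_eq_zero_of_natDegree_lt (by rw [hP.natDegree_eq]; exact hk)
  have hlead : (P n).coeff n = 1 := by
    have := (hP.monic n).coeff_natDegree
    rwa [hP.natDegree_eq] at this
  have hdeg : (diffOp κ S H Z (P n) - C Λ * P n).degree < n := by
    rw [degree_lt_iff_coeff_zero]
    intro k hk
    rw [coeff_sub, coeff_diffOp, coeff_C_mul, hlt (k + 2) (by omega), hlt (k + 1) (by omega)]
    rcases eq_or_lt_of_le hk with rfl | hk
    · rw [hlead, hΛ, one_mul, one_mul, mul_one, zero_mul]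
      module
    · rw [hlt k hk]
      simp
  refine sub_eq_zero.mp (eq_zero_of_matInner_self _ ?_)
  rw [matInner_sub_left, hsymm, matInner_C_mul_left, hP.matInner_eq_zero n _ hdeg,
    hP.matInner_eq_zero n _ (degree_diffOp_lt _ _ _ _ _ _ hdeg), Matrix.mul_zero, sub_zero]

end Orthogonality

/-! ### The hypergeometric recursion -/

section Recursion

open Polynomial

/-- The matrix `S` of the operator `D + α E = diffOp 1 S H Z`. -/
def combS (N : ℕ) (α : ℝ) : Mat N :=
  raiseMat N + lowerMat N + (α / N : ℂ) • (raiseMat N - lowerMat N)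

/-- The diagonal of the matrix `H` of the operator `D + α E = diffOp 1 S H Z`. -/
def combH (N : ℕ) (α : ℝ) (i : Fin (N + 1)) : ℂ :=
  -((N : ℂ) + 3) - (α / N : ℂ) * ((N : ℂ) - 2 * (i : ℕ))

/-- The diagonal of the matrix `Z` of the operator `D + α E = diffOp 1 S H Z`. -/
def combZ (N : ℕ) (α : ℝ) (i : Fin (N + 1)) : ℂ :=
  ((i : ℕ) : ℂ) * ((N : ℂ) - (i : ℕ)) + (α / N : ℂ) * (((N : ℂ) + 2) * (((i : ℕ) : ℂ) - N))

/-- This and the next three normal forms include `ℓ = 0`: division by `N = 0` gives `0`, so all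
terms with `α` vanish together. -/
lemma Cα_eq (N : ℕ) (α : ℝ) :
    Cα N α = (-(1 / 2) : ℂ) • (combS N α + Matrix.diagonal (combH N α)) := by
  have h : Matrix.diagonal (combH N α) =
      (-((N : ℂ) + 3)) • (1 : Mat N) - (α / N : ℂ) • wtMat N := by
    ext i j
    rcases eq_or_ne i j with rfl | h
    · simp [combH, wtMat]
    · simp [h, wtMat]
  rw [h, Cα, matC_eq, matB0_eq, combS, smul_smul,
    show (α : ℂ) * (1 / (2 * N)) = (1 / 2) * (α / N) by
      rw [one_div, mul_inv]; ring]
  module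

lemma Uα_eq (N : ℕ) (α : ℝ) : Uα N α = Matrix.diagonal fun i => -combH N α i := by
  rw [Uα, matU, matB1_eq]
  ext i j
  rcases eq_or_ne i j with rfl | h
  · simp [combH, wtMat]
    ring
  · simp [h, wtMat]

lemma Vα_eq (N : ℕ) (α : ℝ) : Vα N α = Matrix.diagonal fun i => -combZ N α i := by
  rw [Vα, matV, matA0]
  ext i j
  rcases eq_or_ne i j with rfl | h
  · simp [combZ]
    ring
  · simp [h]

lemma eig_eq (N n : ℕ) (α : ℝ) (i : Fin (N + 1)) :
    eig N n α i = -((n : ℂ) * (n - 1)) + n * combH N α i + combZ N α i := by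
  rw [eig, eigD, eigE, combH, combZ]
  rcases eq_or_ne (N : ℂ) 0 with h | h
  · simp [h]
    ring
  · field_simp
    ring

/-- The equation for `D` plus `α / N` times the one for `opE`, which is `N E`. The diagonal
eigenvalue stands on the left, so each row satisfies its own equation with a scalar eigenvalue. -/
lemma diffOp_comb_eq {N : ℕ} {P : ℕ → (Mat N)[X]} (hP : IsMonicOrthogonal N P) (α : ℝ) (n : ℕ) :
    diffOp 1 (combS N α) (Matrix.diagonal (combH N α)) (Matrix.diagonal (combZ N α)) (P n) =
      C (Matrix.diagonal (eig N n α)) * P n := by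
  have hH : Matrix.diagonal (combH N α) =
      (-((N : ℂ) + 3)) • (1 : Mat N) + (α / N : ℂ) • (-wtMat N) := by
    ext i j
    rcases eq_or_ne i j with rfl | h
    · simp [combH, wtMat]
      ring
    · simp [h, wtMat]
  have hZ : Matrix.diagonal (combZ N α) =
      (Matrix.diagonal fun i : Fin (N + 1) => ((i : ℕ) : ℂ) * ((N : ℂ) - (i : ℕ))) + (α / N : ℂ) •
        Matrix.diagonal fun i : Fin (N + 1) => ((N : ℂ) + 2) * (((i : ℕ) : ℂ) - N) := by
    ext i j
    rcases eq_or_ne i j with rfl | h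
    · simp [combZ]
    · simp [h]
  have hΛ : Matrix.diagonal (eig N n α) = -((n : ℂ) * (n - 1)) • (1 : Mat N) +
      (n : ℂ) • Matrix.diagonal (combH N α) + Matrix.diagonal (combZ N α) := by
    ext i j
    rcases eq_or_ne i j with rfl | h
    · simp [eig_eq]
    · simp [h]
  have hD := hP.diffOp_eq _ _ _ _ (matInner_opD (N := N)) n
  have hE := hP.diffOp_eq _ _ _ _ (matInner_opE (N := N)) n
  ext1 k
  have hD := congrArg (fun f => f.coeff k) hD
  have hE := congrArg (fun f => f.coeff k) hE
  simp only [coeff_diffOp, coeff_C_mul, Complex.ofReal_one, Complex.ofReal_zero, zero_mul, neg_zero,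
    zero_smul] at hD hE ⊢
  rw [hΛ, hH, hZ, combS]
  generalize (Matrix.diagonal fun i : Fin (N + 1) => ((i : ℕ) : ℂ) * ((N : ℂ) - (i : ℕ))) = ZD at *
  generalize (Matrix.diagonal fun i : Fin (N + 1) => ((N : ℂ) + 2) * (((i : ℕ) : ℂ) - N)) = ZE at *
  simp only [mul_add, add_mul, mul_sub, mul_neg, neg_mul, smul_mul_assoc, mul_smul_comm, mul_one,
    one_mul, smul_neg, zero_mul] at hD hE ⊢
  linear_combination (norm := module) hD + (α / N : ℂ) • hE

/-- The entry `(i, j)` of a matrix polynomial. -/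
def entryPoly {N : ℕ} (P : (Mat N)[X]) (i j : Fin (N + 1)) : ℂ[X] :=
  ∑ k ∈ Finset.range (P.natDegree + 1), monomial k (P.coeff k i j)

lemma coeff_entryPoly {N : ℕ} (P : (Mat N)[X]) (i j : Fin (N + 1)) (k : ℕ) :
    (entryPoly P i j).coeff k = P.coeff k i j := by
  simp only [entryPoly, finsetSum_coeff, coeff_monomial, Finset.sum_ite_eq', Finset.mem_range]
  split_ifs with h
  · rfl
  · rw [coeff_eq_zero_of_natDegree_lt (p := P) (by omega), Matrix.zero_apply]

lemma eval_entryPoly {N : ℕ} (P : (Mat N)[X]) (i j : Fin (N + 1)) (x : ℂ) :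
    (entryPoly P i j).eval x = matEval P x i j := by
  rw [matEval_eq_sum, Matrix.sum_apply, entryPoly, eval_finsetSum]
  refine Finset.sum_congr rfl fun k _ => ?_
  rw [eval_monomial, Matrix.smul_apply, smul_eq_mul, mul_comm]

/-- The entries of `rescaled` as polynomials. -/
def rescaledPoly {N : ℕ} (P : ℕ → (Mat N)[X]) (n : ℕ) (i j : Fin (N + 1)) : ℂ[X] :=
  C ((-1 : ℂ) ^ n * ((2 : ℂ) ^ n)⁻¹) * (entryPoly (P n) i j).comp (1 + C (-2) * X)

lemma eval_rescaledPoly {N : ℕ} (P : ℕ → (Mat N)[X]) (n : ℕ) (i j : Fin (N + 1)) (u : ℂ) :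
    (rescaledPoly P n i j).eval u = rescaled P n u i j := by
  rw [rescaledPoly, eval_mul, eval_C, eval_comp, eval_entryPoly, rescaled, Matrix.smul_apply,
    smul_eq_mul]
  simp [sub_eq_add_neg]

lemma coeff_comp_one_add_C_mul_X (p : ℂ[X]) (a : ℂ) (n : ℕ) (hp : ∀ k, n < k → p.coeff k = 0) :
    (p.comp (1 + C a * X)).coeff n = p.coeff n * a ^ n := by
  have hn : p.natDegree < n + 1 := Nat.lt_succ_of_le (natDegree_le_iff_coeff_eq_zero.mpr hp)
  rw [comp, eval₂_eq_sum_range' C hn, finsetSum_coeff, Finset.sum_range_succ,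
    Finset.sum_eq_zero, zero_add, coeff_C_mul, coeff_one_add_C_mul_X_pow, Nat.choose_self,
    Nat.cast_one, one_mul]
  intro k hk
  rw [coeff_C_mul, coeff_one_add_C_mul_X_pow, Nat.choose_eq_zero_of_lt (Finset.mem_range.mp hk)]
  simp

lemma coeff_rescaledPoly_of_le {N : ℕ} {P : ℕ → (Mat N)[X]} (hP : IsMonicOrthogonal N P)
    (n k : ℕ) (hk : n ≤ k) (i j : Fin (N + 1)) :
    (rescaledPoly P n i j).coeff k = if k = n then (1 : Mat N) i j else 0 := by
  have h0 (k : ℕ) (hk : n < k) : (entryPoly (P n) i j).coeff k = 0 := by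
    rw [coeff_entryPoly, coeff_eq_zero_of_natDegree_lt (by rw [hP.natDegree_eq]; exact hk),
      Matrix.zero_apply]
  rw [rescaledPoly, coeff_C_mul,
    coeff_comp_one_add_C_mul_X _ _ k (fun l hl => h0 l (hk.trans_lt hl))]
  rcases eq_or_lt_of_le hk with rfl | hk
  · have hlead : (P n).coeff n = 1 := by
      have := (hP.monic n).coeff_natDegree
      rwa [hP.natDegree_eq] at this
    rw [if_pos rfl, coeff_entryPoly, hlead, show (-2 : ℂ) = -1 * 2 by norm_num, mul_pow]
    have h1 : ((-1 : ℂ) ^ n) * (-1) ^ n = 1 := by rw [← mul_pow]; norm_num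
    have h2 : ((2 : ℂ) ^ n)⁻¹ * 2 ^ n = 1 := inv_mul_cancel₀ (by positivity)
    linear_combination (((2 : ℂ) ^ n)⁻¹ * 2 ^ n) * (1 : Mat N) i j * h1 + (1 : Mat N) i j * h2
  · rw [if_neg hk.ne', h0 k hk]
    simp

lemma entryPoly_ode {N : ℕ} {P : ℕ → (Mat N)[X]} (hP : IsMonicOrthogonal N P) (α : ℝ) (n : ℕ)
    (i j : Fin (N + 1)) :
    (1 - X ^ 2) * derivative (derivative (entryPoly (P n) i j)) +
      ∑ l, C (combS N α l j) * derivative (entryPoly (P n) i l) +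
      C (combH N α j) * (X * derivative (entryPoly (P n) i j)) +
      C (combZ N α j) * entryPoly (P n) i j = C (eig N n α i) * entryPoly (P n) i j := by
  ext k
  have h := congrArg (fun f => f.coeff k i j) (diffOp_comb_eq hP α n)
  simp only [coeff_diffOp, coeff_C_mul, Matrix.add_apply, Matrix.sub_apply, Matrix.smul_apply,
    Matrix.mul_diagonal, Matrix.diagonal_mul, smul_eq_mul, Complex.ofReal_one] at h
  simp only [Matrix.mul_apply, ← coeff_entryPoly] at h
  simp only [coeff_add, coeff_C_mul, finsetSum_coeff, sub_mul, one_mul, coeff_sub]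
  rw [← h]
  have hsum : ∑ l, combS N α l j * (derivative (entryPoly (P n) i l)).coeff k =
      ((k : ℂ) + 1) * ∑ l, (entryPoly (P n) i l).coeff (k + 1) * combS N α l j := by
    rw [Finset.mul_sum]
    refine Finset.sum_congr rfl fun l _ => ?_
    rw [coeff_derivative]
    ring
  rw [hsum]
  rcases k with _ | _ | k
  · simp [coeff_derivative]
    ring
  · simp [coeff_derivative, coeff_X_pow_mul', coeff_X_mul]
    ring
  · simp only [coeff_X_mul, coeff_X_pow_mul, coeff_derivative]
    push_cast
    ring

/-- Under `x = 1 - 2u` one has `1 - x² = 4u(1 - u)` and `d/dx = -½ d/du`. For the transposed row `y`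
the equation is `u(1 - u) y'' + (C_αᵗ - u U_αᵗ) y' - (V_αᵗ + λ) y = 0`. -/
lemma rescaledPoly_ode {N : ℕ} {P : ℕ → (Mat N)[X]} (hP : IsMonicOrthogonal N P) (α : ℝ) (n : ℕ)
    (i j : Fin (N + 1)) :
    X * derivative (derivative (rescaledPoly P n i j)) -
      X * (X * derivative (derivative (rescaledPoly P n i j))) +
      ∑ l, C (-(1 / 2) * combS N α l j) * derivative (rescaledPoly P n i l) +
      C (-(1 / 2) * combH N α j) * derivative (rescaledPoly P n i j) +
      C (combH N α j) * (X * derivative (rescaledPoly P n i j)) +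
      C (combZ N α j) * rescaledPoly P n i j = C (eig N n α i) * rescaledPoly P n i j := by
  set c : ℂ := (-1 : ℂ) ^ n * ((2 : ℂ) ^ n)⁻¹ with hc
  have h2 : (C (1 / 2) : ℂ[X]) * 2 = 1 := by
    rw [show (2 : ℂ[X]) = C 2 from rfl, ← C_mul]; norm_num
  have hC2 : (C (-2) : ℂ[X]) = -2 := by rw [C_neg]; rfl
  set r : ℂ[X] := 1 + C (-2) * X with hr
  have hr' : r = 1 - 2 * X := by rw [hr, hC2]; ring
  have dr : derivative r = -2 := by
    rw [hr, derivative_add, derivative_one, derivative_C_mul, derivative_X, hC2]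
    ring
  have d1 (l : Fin (N + 1)) : derivative (rescaledPoly P n i l) =
      -2 * (C c * (derivative (entryPoly (P n) i l)).comp r) := by
    rw [rescaledPoly, derivative_C_mul, derivative_comp, ← hc, ← hr, dr]
    ring
  have d2 : derivative (derivative (rescaledPoly P n i j)) =
      4 * (C c * (derivative (derivative (entryPoly (P n) i j))).comp r) := by
    rw [d1, ← hC2, derivative_C_mul, derivative_C_mul, derivative_comp, dr, hC2]
    ring
  have h := congrArg (fun f => C c * f.comp r) (entryPoly_ode hP α n i j)
  simp only [add_comp, mul_comp, sub_comp, pow_comp, one_comp, X_comp, C_comp,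
    Polynomial.sum_comp] at h
  have hsum : ∑ l, C (-(1 / 2) * combS N α l j) * derivative (rescaledPoly P n i l) =
      C c * ∑ l, C (combS N α l j) * (derivative (entryPoly (P n) i l)).comp r := by
    rw [Finset.mul_sum]
    refine Finset.sum_congr rfl fun l _ => ?_
    rw [d1, C_mul, C_neg]
    linear_combination (C (combS N α l j) * C c *
      (derivative (entryPoly (P n) i l)).comp r) * h2
  rw [hsum, d2, d1, rescaledPoly, ← hc, ← hr, C_mul (a := -(1 / 2)), C_neg]
  generalize (derivative (derivative (entryPoly (P n) i j))).comp r = p2 at *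
  generalize ∑ l, C (combS N α l j) * (derivative (entryPoly (P n) i l)).comp r = p3 at *
  generalize (derivative (entryPoly (P n) i j)).comp r = p1 at *
  generalize (entryPoly (P n) i j).comp r = p0 at *
  rw [hr'] at h
  linear_combination h + (C (combH N α j) * C c * p1) * h2

/-- The vectors `k! · (k-th coefficient)` of the `i`-th row of `rescaled`. -/
def rowCoeff {N : ℕ} (P : ℕ → (Mat N)[X]) (n : ℕ) (i : Fin (N + 1)) (k : ℕ) :
    Fin (N + 1) → ℂ :=
  fun j => (k.factorial : ℂ) * (rescaledPoly P n i j).coeff k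

/-- The recursion numerator compares the eigenvalue of the row with those in degree `k`. Thus
invertibility of the bracket reduces to non-coincidence of eigenvalues. -/
lemma step_eq_diagonal (N n : ℕ) (α : ℝ) (i : Fin (N + 1)) (k : ℕ) :
    (k : ℂ) ^ 2 • (1 : Mat N) + (k : ℂ) • ((Uα N α)ᵀ - 1) + shiftedV N n α i =
      Matrix.diagonal fun j => eig N n α i - eig N k α j := by
  rw [shiftedV, Uα_eq, Vα_eq]
  ext l j
  rcases eq_or_ne l j with rfl | h
  · simp [eig_eq N k]
    ring
  · simp [h]

lemma rowCoeff_rec {N : ℕ} {P : ℕ → (Mat N)[X]} (hP : IsMonicOrthogonal N P) (α : ℝ) (n : ℕ)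
    (i : Fin (N + 1)) (k : ℕ) :
    ((Cα N α)ᵀ + (k : ℂ) • (1 : Mat N)) *ᵥ rowCoeff P n i (k + 1) =
      ((k : ℂ) ^ 2 • (1 : Mat N) + (k : ℂ) • ((Uα N α)ᵀ - 1) + shiftedV N n α i) *ᵥ
        rowCoeff P n i k := by
  rw [step_eq_diagonal]
  ext j
  have h := congrArg (fun f => f.coeff k) (rescaledPoly_ode hP α n i j)
  simp only [coeff_add, coeff_sub, coeff_C_mul, finsetSum_coeff] at h
  have hX2 : (X * (X * derivative (derivative (rescaledPoly P n i j)))).coeff k =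
      (k : ℂ) * (k - 1) * (rescaledPoly P n i j).coeff k := by
    rcases k with _ | _ | k
    · simp
    · simp [coeff_X_mul]
    · simp only [coeff_X_mul, coeff_derivative]
      push_cast
      ring
  have hX1 : (X * derivative (derivative (rescaledPoly P n i j))).coeff k =
      (k : ℂ) * (k + 1) * (rescaledPoly P n i j).coeff (k + 1) := by
    rcases k with _ | k
    · simp
    · simp only [coeff_X_mul, coeff_derivative]
      push_cast
      ring
  have hX : (X * derivative (rescaledPoly P n i j)).coeff k =
      (k : ℂ) * (rescaledPoly P n i j).coeff k := by
    rcases k with _ | k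
    · simp
    · simp only [coeff_X_mul, coeff_derivative]
      push_cast
      ring
  rw [hX2, hX1, hX] at h
  simp only [coeff_derivative] at h
  rw [Matrix.mulVec_diagonal, Matrix.add_mulVec, Pi.add_apply, Matrix.smul_mulVec,
    Matrix.one_mulVec, Pi.smul_apply, smul_eq_mul, Cα_eq, Matrix.transpose_smul,
    Matrix.smul_mulVec, Matrix.transpose_add, Matrix.diagonal_transpose, Matrix.add_mulVec,
    Pi.smul_apply, Pi.add_apply, Matrix.mulVec_diagonal, smul_eq_mul]
  have hsum : ((combS N α)ᵀ *ᵥ rowCoeff P n i (k + 1)) j =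
      -2 * (k.factorial : ℂ) * ∑ l, -(1 / 2) * combS N α l j *
        ((rescaledPoly P n i l).coeff (k + 1) * ((k : ℂ) + 1)) := by
    rw [Matrix.mulVec, dotProduct, Finset.mul_sum]
    refine Finset.sum_congr rfl fun l _ => ?_
    rw [Matrix.transpose_apply, rowCoeff, Nat.factorial_succ]
    push_cast
    ring
  rw [hsum, eig_eq N k]
  simp only [rowCoeff, Nat.factorial_succ]
  push_cast
  linear_combination (k.factorial : ℂ) * h

end Recursion

section Hypergeometric

open Polynomial

/-! ### Invertibility of `C_α + k` -/

/-- If `p ≠ 0` vanishes to order `d` at `1`, dividing the equation by `(X - 1)^d` and setting `X =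
1` leaves `N - 2d - μ = 0`. -/
lemma eq_zero_of_ode {N : ℕ} (t μ : ℂ) (hμ : ∀ d : ℕ, (N : ℂ) - 2 * d ≠ μ) (p : ℂ[X])
    (h : (1 - X) * (C (1 - t) + C (1 + t) * X) * derivative p +
      (C (N * (1 + t)) * X - C (t * N + μ)) * p = 0) : p = 0 := by
  by_contra hp
  obtain ⟨g, hg, hdvd⟩ := exists_eq_pow_rootMultiplicity_mul_and_not_dvd p hp 1
  set d := p.rootMultiplicity 1
  have hg1 : g.eval 1 ≠ 0 := fun h0 => hdvd (dvd_iff_isRoot.mpr h0)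
  have hd : (X - C 1) * derivative p =
        (X - C 1) ^ d * ((d : ℂ[X]) * g + (X - C 1) * derivative g) := by
    conv_lhs => rw [hg]
    rw [derivative_mul]
    rcases d with _ | d
    · simp
    · rw [derivative_X_sub_C_pow, Nat.add_sub_cancel, map_natCast]
      push_cast
      ring
  have h2 : (X - C 1) ^ d * (-(C (1 - t) + C (1 + t) * X) * ((d : ℂ[X]) * g +
      (X - C 1) * derivative g) + (C (N * (1 + t)) * X - C (t * N + μ)) * g) = 0 := by
    rw [mul_add, ← mul_assoc _ _ g, mul_comm _ (C (N * (1 + t)) * X - C (t * N + μ)),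
      mul_assoc _ _ g,
      ← hg, ← h, C_1]
    rw [C_1] at hd
    linear_combination (C (1 - t) + C (1 + t) * X) * hd
  have h3 := (mul_eq_zero.mp h2).resolve_left (pow_ne_zero _ (X_sub_C_ne_zero 1))
  have h4 := congrArg (eval 1) h3
  simp only [eval_add, eval_mul, eval_neg, eval_sub, eval_C, eval_X, eval_natCast, eval_zero] at h4
  refine hμ d ?_
  have h5 : ((N : ℂ) - 2 * d - μ) * g.eval 1 = 0 := by linear_combination h4
  exact sub_eq_zero.mp ((mul_eq_zero.mp h5).resolve_right hg1)

lemma sum_mul_raiseMat {N : ℕ} (j : Fin (N + 1)) (f : ℕ → ℂ) :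
    ∑ i, raiseMat N i j * f (i : ℕ) =
      if (j : ℕ) = 0 then 0 else ((N : ℂ) + 1 - (j : ℕ)) * f ((j : ℕ) - 1) := by
  simp only [raiseMat, Matrix.of_apply, ite_mul, zero_mul]
  split_ifs with h
  · refine Finset.sum_eq_zero fun b _ => ?_
    rw [if_neg]
    omega
  · rw [Finset.sum_eq_single (⟨(j : ℕ) - 1, by omega⟩ : Fin (N + 1))]
    · rw [if_pos (by simp; omega)]
      simp only []
      rw [Nat.cast_sub (by omega)]
      push_cast
      ring
    · intro b _ hb
      rw [if_neg]
      exact fun h' => hb (Fin.ext (by simp; omega))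
    · simp

lemma sum_mul_lowerMat {N : ℕ} (j : Fin (N + 1)) (f : ℕ → ℂ) (hf : f (N + 1) = 0) :
    ∑ i, lowerMat N i j * f (i : ℕ) = (((j : ℕ) : ℂ) + 1) * f ((j : ℕ) + 1) := by
  simp only [lowerMat, Matrix.of_apply, ite_mul, zero_mul]
  rcases Nat.lt_or_ge (j : ℕ) N with h | h
  · rw [Finset.sum_eq_single (⟨(j : ℕ) + 1, by omega⟩ : Fin (N + 1))]
    · simp
    · intro b _ hb
      rw [if_neg]
      exact fun h' => hb (Fin.ext (by simp; omega))
    · simp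
  · have hj : (j : ℕ) = N := by omega
    rw [hj, hf, mul_zero]
    refine Finset.sum_eq_zero fun b _ => ?_
    rw [if_neg]
    omega

/-- Up to an affine change, `C_α` is the image in the spin-`ℓ` representation of a `2 × 2` matrix
with eigenvalues `±1` for every `α`, so its eigenvalues are `d + 3/2`. The proof turns a null vector
into the coefficients of a polynomial solving the equation of `eq_zero_of_ode` with `μ = N + 3 +
2k`, which exceeds every `N - 2d`. -/
theorem isUnit_Cα_add (N : ℕ) (α : ℝ) (k : ℕ) :
    IsUnit ((Cα N α)ᵀ + (k : ℂ) • (1 : Mat N)) := by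
  rw [← Matrix.mulVec_injective_iff_isUnit]
  have key (v : Fin (N + 1) → ℂ) (hv : ((Cα N α)ᵀ + (k : ℂ) • (1 : Mat N)) *ᵥ v = 0) : v = 0 := by
    set t : ℂ := α / N with ht
    set V : ℕ → ℂ := fun l => if h : l < N + 1 then v ⟨l, h⟩ else 0 with hV
    have hVv (i : Fin (N + 1)) : V (i : ℕ) = v i := dif_pos i.2
    have hV0 (l : ℕ) (hl : N < l) : V l = 0 := by
      simp only [hV]
      rw [dif_neg (by omega)]
    have hentry (j : Fin (N + 1)) :
        (1 + t) * (if (j : ℕ) = 0 then 0 else ((N : ℂ) + 1 - (j : ℕ)) * V ((j : ℕ) - 1)) +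
          (1 - t) * ((((j : ℕ) : ℂ) + 1) * V ((j : ℕ) + 1)) -
          t * ((N : ℂ) - 2 * (j : ℕ)) * V (j : ℕ) - (N + 3 + 2 * k) * V (j : ℕ) = 0 := by
      have h := congrFun hv j
      rw [Matrix.add_mulVec, Pi.add_apply, Matrix.smul_mulVec,
        Matrix.one_mulVec, Pi.smul_apply, smul_eq_mul, Cα_eq, Matrix.transpose_smul,
        Matrix.smul_mulVec, Matrix.transpose_add, Matrix.diagonal_transpose, Matrix.add_mulVec,
        Pi.smul_apply, Pi.add_apply, Matrix.mulVec_diagonal, smul_eq_mul, Pi.zero_apply,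
        Matrix.mulVec, dotProduct] at h
      have hsum : ∑ i, (combS N α)ᵀ j i * v i =
          (1 + t) * ∑ i, raiseMat N i j * V (i : ℕ) +
            (1 - t) * ∑ i, lowerMat N i j * V (i : ℕ) := by
        rw [Finset.mul_sum, Finset.mul_sum, ← Finset.sum_add_distrib]
        refine Finset.sum_congr rfl fun i _ => ?_
        simp only [combS, Matrix.transpose_apply, Matrix.add_apply, Matrix.sub_apply,
          Matrix.smul_apply, smul_eq_mul, hVv, ← ht]
        ring
      rw [hsum, sum_mul_raiseMat j V, sum_mul_lowerMat j V (hV0 _ (by omega)), ← hVv j, combH,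
        ← ht] at h
      linear_combination -2 * h
    set p : ℂ[X] := ∑ l ∈ Finset.range (N + 1), monomial l (V l) with hp
    have hcoeff (l : ℕ) : p.coeff l = V l := by
      simp only [hp, finsetSum_coeff, coeff_monomial, Finset.sum_ite_eq', Finset.mem_range]
      split_ifs with h
      · rfl
      · exact (hV0 l (by omega)).symm
    have hode : (1 - X) * (C (1 - t) + C (1 + t) * X) * derivative p +
        (C (N * (1 + t)) * X - C (t * N + (N + 3 + 2 * k))) * p = 0 := by
      have hexp : (1 - X) * (C (1 - t) + C (1 + t) * X) * derivative p +
          (C (N * (1 + t)) * X - C (t * N + (N + 3 + 2 * k))) * p =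
          C (1 - t) * derivative p + C (2 * t) * (X * derivative p) -
            C (1 + t) * (X ^ 2 * derivative p) + C (N * (1 + t)) * (X * p) -
            C (t * N + (N + 3 + 2 * k)) * p := by
        simp only [C_sub, C_add, C_mul, C_1, show (C 2 : ℂ[X]) = 2 from rfl]
        ring
      rw [hexp]
      ext l
      simp only [coeff_add, coeff_sub, coeff_C_mul, coeff_zero]
      have hE : (1 + t) * (if l = 0 then 0 else ((N : ℂ) + 1 - l) * V (l - 1)) +
          (1 - t) * (((l : ℂ) + 1) * V (l + 1)) -
          t * ((N : ℂ) - 2 * l) * V l - (N + 3 + 2 * k) * V l = 0 := by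
        rcases Nat.lt_or_ge N l with h | h
        · rw [hV0 l h, hV0 (l + 1) (by omega), if_neg (by omega)]
          rcases eq_or_lt_of_le (Nat.succ_le_of_lt h) with rfl | h
          · push_cast
            ring
          · rw [hV0 (l - 1) (by omega)]
            ring
        · exact hentry ⟨l, by omega⟩
      rcases l with _ | _ | l
      · simp [coeff_derivative, hcoeff] at hE ⊢
        linear_combination hE
      · simp [coeff_derivative, coeff_X_mul, coeff_X_pow_mul', hcoeff] at hE ⊢
        linear_combination hE
      · simp only [coeff_derivative, coeff_X_mul, coeff_X_pow_mul, hcoeff, Nat.add_sub_cancel,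
          if_neg (Nat.succ_ne_zero _)] at hE ⊢
        push_cast at hE ⊢
        linear_combination hE
    have hp0 : p = 0 := by
      refine eq_zero_of_ode t _ (fun d hd => ?_) p hode
      have : ((2 * d + 3 + 2 * k : ℕ) : ℂ) = 0 := by
        push_cast
        linear_combination -hd
      have := Nat.cast_eq_zero.mp this
      omega
    ext i
    rw [← hVv, ← hcoeff, hp0]
    simp
  intro v w h
  exact sub_eq_zero.mp (key (v - w) (by
    have h : _ *ᵥ v = _ *ᵥ w := h
    rw [Matrix.mulVec_sub, h, sub_self]))

/-! ### Convergence of the hypergeometric series -/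

attribute [local instance] Matrix.linftyOpNormedRing Matrix.linftyOpNormedAlgebra

/-- Numerator and denominator are divided by `k²` and `k`; inversion is continuous at `1`. This is
the ratio of consecutive terms, apart from the factor `u`. -/
lemma tendsto_step {N : ℕ} (A U V : Mat N) (hA : ∀ k : ℕ, IsUnit (A + (k : ℂ) • (1 : Mat N))) :
    Filter.Tendsto (fun k : ℕ => ((k : ℂ) + 1)⁻¹ • ((A + (k : ℂ) • (1 : Mat N))⁻¹ *
      ((k : ℂ) ^ 2 • (1 : Mat N) + (k : ℂ) • (U - 1) + V))) Filter.atTop (𝓝 1) := by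
  have hinv : Filter.Tendsto (fun k : ℕ => ((k : ℂ))⁻¹) Filter.atTop (𝓝 0) :=
    tendsto_inv_atTop_nhds_zero_nat
  have h1 : Filter.Tendsto (fun k : ℕ => ((k : ℂ))⁻¹ • A + 1) Filter.atTop (𝓝 (1 : Mat N)) := by
    simpa using (hinv.smul_const A).add_const (1 : Mat N)
  have h2 : Filter.Tendsto (fun k : ℕ => (((k : ℂ))⁻¹ • A + 1)⁻¹) Filter.atTop
      (𝓝 (1 : Mat N)) := by
    have hc : ContinuousAt Ring.inverse (1 : Mat N) := by
      have h := NormedRing.inverse_continuousAt (1 : (Mat N)ˣ)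
      rw [Units.val_one] at h
      exact h
    have := hc.tendsto.comp h1
    simp only [Ring.inverse_one] at this
    refine this.congr fun k => ?_
    rw [Function.comp_apply, Matrix.nonsing_inv_eq_ringInverse]
  have h3 : Filter.Tendsto (fun k : ℕ => (1 : Mat N) + (k : ℂ)⁻¹ • (U - 1) +
      ((k : ℂ)⁻¹ * (k : ℂ)⁻¹) • V) Filter.atTop (𝓝 1) := by
    simpa using ((hinv.smul_const (U - 1)).const_add (1 : Mat N)).add
      ((hinv.mul hinv).smul_const V)
  have h4 : Filter.Tendsto (fun k : ℕ => (k : ℂ) / ((k : ℂ) + 1)) Filter.atTop (𝓝 1) :=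
    tendsto_natCast_div_add_atTop 1
  have h5 := h4.smul (h2.mul h3)
  rw [one_mul, one_smul] at h5
  refine h5.congr' ?_
  filter_upwards [Filter.eventually_gt_atTop 0] with k hk
  have hk0 : (k : ℂ) ≠ 0 := by exact_mod_cast hk.ne'
  have e1 : ((k : ℂ)⁻¹ • A + 1)⁻¹ = (k : ℂ) • (A + (k : ℂ) • (1 : Mat N))⁻¹ := by
    have hdet := (Matrix.isUnit_iff_isUnit_det _).mp (hA k)
    refine Matrix.inv_eq_right_inv ?_
    rw [show (k : ℂ)⁻¹ • A + 1 = (k : ℂ)⁻¹ • (A + (k : ℂ) • (1 : Mat N)) by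
      rw [smul_add, smul_smul, inv_mul_cancel₀ hk0, one_smul], smul_mul_assoc, mul_smul_comm,
      smul_smul, inv_mul_cancel₀ hk0, one_smul, Matrix.mul_nonsing_inv _ hdet]
  have e2 : (k : ℂ) ^ 2 • (1 : Mat N) + (k : ℂ) • (U - 1) + V = (k : ℂ) ^ 2 •
      ((1 : Mat N) + (k : ℂ)⁻¹ • (U - 1) + ((k : ℂ)⁻¹ * (k : ℂ)⁻¹) • V) := by
    rw [smul_add, smul_add, smul_smul, smul_smul]
    congr 2
    · congr 2
      field_simp
    · rw [show (k : ℂ) ^ 2 * ((k : ℂ)⁻¹ * (k : ℂ)⁻¹) = 1 by field_simp, one_smul]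
  rw [e1, e2, smul_mul_assoc, mul_smul_comm, smul_smul, smul_smul]
  congr 1
  have : (k : ℂ) + 1 ≠ 0 := Nat.cast_add_one_ne_zero k
  field_simp

theorem summable_bracket {N : ℕ} (A U V : Mat N)
    (hA : ∀ k : ℕ, IsUnit (A + (k : ℂ) • (1 : Mat N))) (u : ℂ) (hu : ‖u‖ < 1) :
    Summable fun k : ℕ => (u ^ k / (k.factorial : ℂ)) • bracket A U V k := by
  have hlim := ((tendsto_step A U V hA).norm).const_mul ‖u‖
  rw [norm_one, mul_one] at hlim
  obtain ⟨r, hur, hr⟩ := exists_between hu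
  have : CompleteSpace (Mat N) := FiniteDimensional.complete ℂ _
  refine summable_of_ratio_norm_eventually_le hr ?_
  filter_upwards [hlim.eventually_lt_const hur] with k hk
  set M := (A + (k : ℂ) • (1 : Mat N))⁻¹ *
      ((k : ℂ) ^ 2 • (1 : Mat N) + (k : ℂ) • (U - 1) + V) with hM
  have hstep : (u ^ (k + 1) / ((k + 1).factorial : ℂ)) • bracket A U V (k + 1) =
      (u • (((k : ℂ) + 1)⁻¹ • M)) * ((u ^ k / (k.factorial : ℂ)) • bracket A U V k) := by
    rw [bracket, ← hM, smul_mul_assoc, smul_mul_assoc, mul_smul_comm, smul_smul, smul_smul,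
      Nat.factorial_succ]
    congr 1
    have : (k.factorial : ℂ) ≠ 0 := by exact_mod_cast k.factorial_ne_zero
    have : (k : ℂ) + 1 ≠ 0 := Nat.cast_add_one_ne_zero k
    push_cast
    field_simp
    ring
  rw [hstep]
  refine (norm_mul_le _ _).trans (mul_le_mul_of_nonneg_right ?_ (norm_nonneg _))
  rw [norm_smul]
  exact hk.le

/-! ### The exceptional values of `α` -/

lemma isUnit_rowBracket {N n : ℕ} {α : ℝ} {i : Fin (N + 1)}
    (h : ∀ k < n, ∀ j, eig N n α i ≠ eig N k α j) : IsUnit (rowBracket N n α i n) := by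
  suffices H : ∀ m ≤ n, IsUnit (rowBracket N n α i m) from H n le_rfl
  intro m
  induction m with
  | zero => exact fun _ => isUnit_one
  | succ m ih =>
    intro hm
    rw [rowBracket, bracket, step_eq_diagonal]
    refine (IsUnit.mul ?_ ?_).mul (ih (by omega))
    · exact Matrix.isUnit_nonsing_inv_iff.mpr (isUnit_Cα_add N α m)
    · rw [Matrix.isUnit_diagonal, Pi.isUnit_iff]
      exact fun j => (sub_ne_zero.mpr (h m (by omega) j)).isUnit

/-- Up to sign and a constant, the sum and the difference of the eigenvalues of `D` and `2ℓ E` are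
`a(a + 2)` with `a = n + N - i` and `a = n + i`. As `a ↦ a(a + 2)` is injective on `a ≥ 0`, both
values of `a`, and so `n`, are determined. -/
lemma eig_pair_separate {N n k i j : ℕ} (hi : i ≤ N) (hj : j ≤ N) (hk : k < n)
    (hD : (-(n * (n - 1)) - n * (N + 3) + i * (N - i) : ℚ) =
      -(k * (k - 1)) - k * (N + 3) + j * (N - j))
    (hE : (-(n * (N - 2 * i)) + (N + 2) * (i - N) : ℚ) =
      -(k * (N - 2 * j)) + (N + 2) * (j - N)) : False := by
  have pos {a b : ℚ} (ha : 0 ≤ a) (hb : 0 ≤ b) (h : a * (a + 2) = b * (b + 2)) : a = b := by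
    have h1 : (a - b) * (a + b + 2) = 0 := by linear_combination h
    rcases mul_eq_zero.mp h1 with h2 | h2
    · exact sub_eq_zero.mp h2
    · linarith
  have hi' : (i : ℚ) ≤ N := by exact_mod_cast hi
  have hj' : (j : ℚ) ≤ N := by exact_mod_cast hj
  have hn : (0 : ℚ) ≤ n := Nat.cast_nonneg n
  have hk0 : (0 : ℚ) ≤ k := Nat.cast_nonneg k
  have hi0 : (0 : ℚ) ≤ i := Nat.cast_nonneg i
  have hj0 : (0 : ℚ) ≤ j := Nat.cast_nonneg j
  have h1 := pos (a := n + N - i) (b := k + N - j) (by linarith) (by linarith)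
    (by linear_combination -hD - hE)
  have h2 := pos (a := n + i) (b := k + j) (by linarith) (by linarith)
    (by linear_combination -hD + hE)
  have h3 : (n : ℚ) = k := by linarith
  have : n = k := by exact_mod_cast h3
  omega

/-- The difference of the eigenvalues is `dD + α dE` with rational coefficients, not both zero by
`eig_pair_separate`. It has at most one zero, and that zero is rational. -/
lemma exists_rat_of_eig_eq {N n k : ℕ} (i j : Fin (N + 1)) (hk : k < n) :
    ∃ q : ℚ, ∀ α : ℝ, eig N n α i = eig N k α j → α = q := by
  set dD : ℚ := (-(n * (n - 1)) - n * (N + 3) + (i : ℕ) * (N - (i : ℕ))) -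
      (-(k * (k - 1)) - k * (N + 3) + (j : ℕ) * (N - (j : ℕ))) with hdD
  set dE : ℚ := ((-(n * (N - 2 * (i : ℕ))) + (N + 2) * ((i : ℕ) - N)) -
      (-(k * (N - 2 * (j : ℕ))) + (N + 2) * ((j : ℕ) - N))) / N with hdE
  have hlin (α : ℝ) : eig N n α i - eig N k α j = (((dD : ℝ) + α * (dE : ℝ) : ℝ) : ℂ) := by
    rw [eig_eq, eig_eq, combH, combH, combZ, combZ, hdD, hdE]
    push_cast
    ring
  have hne : ¬(dD = 0 ∧ dE = 0) := by
    rintro ⟨h1, h2⟩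
    refine eig_pair_separate (N := N) (n := n) (k := k) (i := i) (j := j) (by omega) (by omega) hk
      (sub_eq_zero.mp h1) ?_
    rcases Nat.eq_zero_or_pos N with rfl | hN
    · simp
    · have hN : (N : ℚ) ≠ 0 := by exact_mod_cast hN.ne'
      exact sub_eq_zero.mp ((div_eq_zero_iff.mp h2).resolve_right hN)
  refine ⟨-dD / dE, fun α hα => ?_⟩
  have h := hlin α
  rw [hα, sub_self] at h
  have h : (dD : ℝ) + α * (dE : ℝ) = 0 := by exact_mod_cast h.symm
  have hE : dE ≠ 0 := by
    intro h0
    refine hne ⟨?_, h0⟩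
    rw [h0, Rat.cast_zero, mul_zero, add_zero] at h
    exact_mod_cast h
  have hE' : (dE : ℝ) ≠ 0 := by exact_mod_cast hE
  push_cast
  rw [eq_div_iff hE']
  linear_combination h

theorem finite_not_isUnit_rowBracket (N n : ℕ) (i : Fin (N + 1)) :
    {α : ℝ | ¬ IsUnit (rowBracket N n α i n)}.Finite := by
  have h : ∀ k : Fin n, ∀ j : Fin (N + 1), ∃ q : ℚ, ∀ α : ℝ,
      eig N n α i = eig N k α j → α = q := fun k j => exists_rat_of_eig_eq i j k.2
  choose q hq using h
  refine (Set.finite_range fun x : Fin n × Fin (N + 1) => ((q x.1 x.2 : ℚ) : ℝ)).subset ?_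
  intro α hα
  by_contra hα'
  refine hα (isUnit_rowBracket fun k hk j hkj => hα' ⟨(⟨k, hk⟩, j), ?_⟩)
  exact (hq ⟨k, hk⟩ j α hkj).symm

theorem isUnit_rowBracket_of_irrational (N n : ℕ) (i : Fin (N + 1)) (α : ℝ) (hα : Irrational α) :
    IsUnit (rowBracket N n α i n) := by
  refine isUnit_rowBracket fun k hk j hkj => ?_
  obtain ⟨q, hq⟩ := exists_rat_of_eig_eq i j hk
  exact hα ⟨q, (hq α hkj).symm⟩

/-! ### The row formula -/

lemma rowBracket_mulVec {N : ℕ} {P : ℕ → (Mat N)[X]} (hP : IsMonicOrthogonal N P) (α : ℝ) (n : ℕ)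
    (i : Fin (N + 1)) (k : ℕ) :
    rowBracket N n α i k *ᵥ rowCoeff P n i 0 = rowCoeff P n i k := by
  induction k with
  | zero => rw [rowBracket, bracket, Matrix.one_mulVec]
  | succ k ih =>
    have hdet := (Matrix.isUnit_iff_isUnit_det _).mp (isUnit_Cα_add N α k)
    rw [rowBracket] at ih
    rw [rowBracket, bracket, ← Matrix.mulVec_mulVec, ih, ← Matrix.mulVec_mulVec,
      ← rowCoeff_rec hP α n i k, Matrix.mulVec_mulVec, Matrix.nonsing_inv_mul _ hdet,
      Matrix.one_mulVec]

lemma rowCoeff_self {N : ℕ} {P : ℕ → (Mat N)[X]} (hP : IsMonicOrthogonal N P) (n : ℕ)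
    (i : Fin (N + 1)) : rowCoeff P n i n = (n.factorial : ℂ) • Pi.single i 1 := by
  ext j
  rw [rowCoeff, coeff_rescaledPoly_of_le hP n n le_rfl, if_pos rfl, Pi.smul_apply, smul_eq_mul,
    Matrix.one_apply, Pi.single_apply]
  simp only [eq_comm]

/-- The right side is the `i`-th row of `R_n(0)` and does not involve `α`: the starting vector is
the same for all non-exceptional `α`. -/
lemma rowStart_eq {N : ℕ} {P : ℕ → (Mat N)[X]} (hP : IsMonicOrthogonal N P) (α : ℝ) (n : ℕ)
    (i : Fin (N + 1)) (h : IsUnit (rowBracket N n α i n)) :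
    rowStart N n α i = rowCoeff P n i 0 := by
  have hdet := (Matrix.isUnit_iff_isUnit_det _).mp h
  rw [rowStart, ← Matrix.mulVec_smul, ← rowCoeff_self hP, ← rowBracket_mulVec hP α,
    Matrix.mulVec_mulVec, Matrix.nonsing_inv_mul _ hdet, Matrix.one_mulVec]

theorem rowFormula_rowCoeff {N : ℕ} {P : ℕ → (Mat N)[X]} (hP : IsMonicOrthogonal N P) (α : ℝ)
    (n : ℕ) (i : Fin (N + 1)) : RowFormula N P n α i (rowCoeff P n i 0) := by
  have hvec (u : ℂ) (j : Fin (N + 1)) : HasSum (fun k : ℕ => u ^ k / (k.factorial : ℂ) *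
      (rowBracket N n α i k *ᵥ rowCoeff P n i 0) j) (rescaled P n u i j) := by
    have hterm (k : ℕ) : u ^ k / (k.factorial : ℂ) *
        (rowBracket N n α i k *ᵥ rowCoeff P n i 0) j = (rescaledPoly P n i j).coeff k * u ^ k := by
      rw [rowBracket_mulVec hP, rowCoeff]
      have : (k.factorial : ℂ) ≠ 0 := by exact_mod_cast k.factorial_ne_zero
      field_simp
    simp only [hterm]
    rw [← eval_rescaledPoly, eval_eq_sum_range]
    -- The row is a polynomial, so the vector series is a finite sum and converges for every `u`.
    refine hasSum_sum_of_ne_finset_zero fun k hk => ?_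
    rw [coeff_eq_zero_of_natDegree_lt (by simpa using hk), zero_mul]
  refine ⟨fun u hu j => ?_, hvec⟩
  have hs := (summable_bracket (Cα N α)ᵀ (Uα N α)ᵀ (shiftedV N n α i) (isUnit_Cα_add N α) u
    hu).hasSum
  have hcont : Continuous fun A : Mat N => (A *ᵥ rowCoeff P n i 0) j :=
    (continuous_apply j).comp (continuous_id.matrix_mulVec continuous_const)
  -- Applying the matrix to the vector and taking an entry is continuous and additive, so it passes
  -- through the series in the disc.
  let φ : Mat N →+ ℂ :=
    { toFun := fun A => (A *ᵥ rowCoeff P n i 0) j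
      map_zero' := by simp
      map_add' := fun A B => by simp [Matrix.add_mulVec] }
  have h := hs.map φ hcont
  refine (hvec u j).unique ?_
  have hφ : (⇑φ ∘ fun k : ℕ => (u ^ k / (k.factorial : ℂ)) •
      bracket (Cα N α)ᵀ (Uα N α)ᵀ (shiftedV N n α i) k) = fun k : ℕ =>
        u ^ k / (k.factorial : ℂ) * (rowBracket N n α i k *ᵥ rowCoeff P n i 0) j := by
    ext k
    simp [φ, Matrix.smul_mulVec, rowBracket]
  rw [hφ] at h
  exact h

end Hypergeometric
end MVOP
end

theorem theorem4p4 (N : ℕ) :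
    -- the monic orthogonal polynomials exist and are unique
    (∃! P : ℕ → Polynomial (MVOP.Mat N), MVOP.IsMonicOrthogonal N P) ∧
    ∀ P : ℕ → Polynomial (MVOP.Mat N), MVOP.IsMonicOrthogonal N P →
    ∀ (n : ℕ) (i : Fin (N + 1)),
      -- the hypergeometric function on the right is well defined, for every real `α`
      (∀ (α : ℝ) (k : ℕ), IsUnit ((MVOP.Cα N α)ᵀ + (k : ℂ) • (1 : MVOP.Mat N))) ∧
      (∀ (α : ℝ) (u : ℂ), ‖u‖ < 1 → Summable fun k : ℕ =>
        (u ^ k / (k.factorial : ℂ)) • MVOP.rowBracket N n α i k) ∧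
      -- the matrix to be inverted is invertible, except for finitely many rational `α`
      {α : ℝ | ¬ IsUnit (MVOP.rowBracket N n α i n)}.Finite ∧
      (∀ α : ℝ, Irrational α → IsUnit (MVOP.rowBracket N n α i n)) ∧
      -- the formula, wherever that matrix is invertible
      (∀ α : ℝ, IsUnit (MVOP.rowBracket N n α i n) →
        MVOP.RowFormula N P n α i (MVOP.rowStart N n α i)) ∧
      -- the formula for every real `α`, with the vector extended continuously in `α`
      (∀ α : ℝ, ∃ F : Fin (N + 1) → ℂ,
        Filter.Tendsto (fun β : ℝ => MVOP.rowStart N n β i) (𝓝[≠] α) (𝓝 F) ∧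
        MVOP.RowFormula N P n α i F) := by
  refine ⟨MVOP.existsUnique_isMonicOrthogonal N, fun P hP n i =>
    ⟨MVOP.isUnit_Cα_add N, fun α u hu => MVOP.summable_bracket _ _ _ (MVOP.isUnit_Cα_add N α) u hu,
      MVOP.finite_not_isUnit_rowBracket N n i, MVOP.isUnit_rowBracket_of_irrational N n i,
      fun α h => ?_, fun α => ⟨MVOP.rowCoeff P n i 0, ?_, MVOP.rowFormula_rowCoeff hP α n i⟩⟩⟩
  · rw [MVOP.rowStart_eq hP α n i h]
    exact MVOP.rowFormula_rowCoeff hP α n i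
  -- Near `α`, and away from `α` itself, there are no exceptional values, since they form a finite
  -- set; there the starting vector is constant.
  · refine tendsto_const_nhds.congr' ?_
    have hfin : ({β : ℝ | ¬ IsUnit (MVOP.rowBracket N n β i n)} \ {α}).Finite :=
      (MVOP.finite_not_isUnit_rowBracket N n i).sdiff
    have hnhds := hfin.isClosed.isOpen_compl.mem_nhds (x := α) (by simp)
    filter_upwards [nhdsWithin_le_nhds hnhds, self_mem_nhdsWithin] with β hβ hne
    refine (MVOP.rowStart_eq hP β n i ?_).symm
    by_contra hb
    exact hβ ⟨hb, hne⟩
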